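/- Let $\mathcal L$ be the category of bounded lattices and bounded lattice homomorphisms, and $\mathcal L^+$ the category of complete lattices and complete lattice homomorphisms. Let $2=\{0,1\}$ with $0<1$, regarded as a bounded lattice, as an ordered set, and as a discrete space. For a partial map $f$ into $2$, $f^{-1}(i)$ is the set of points at which $f$ is defined with value $i$; a composite of a partial map with a total map is defined wherever it makes sense. For $L\in\mathcal L$ let $\mathrm{SPH}(L)$ be the set of special partial homomorphisms, i.e. partial maps $f$ from $L$ to $2$ whose domain is a $0,1$-sublattice, which are bounded lattice homomorphisms on their domain, and for which $f^{-1}(1)$ is a filter and $f^{-1}(0)$ is an ideal of $L$. Put $(f,g)\in E$ iff $f(x)\le g(x)$ for all $x\in\mathrm{dom}(f)\cap\mathrm{dom}(g)$, and let $\mathcal T$ be the topology on $\mathrm{SPH}(L)$ in which the sets $\{f : f(a)=0\}$ and $\{f : f(a)=1\}$ $(a\in L)$ form a subbasis of closed sets. An $\mathcal L$-graph (with topology) is a structure isomorphic to $(\mathrm{SPH}(L),E)$ (respectively $(\mathrm{SPH}(L),E,\mathcal T)$) for some $L\in\mathcal L$. On an $\mathcal L$-graph $(X,E)$ let $f\le_1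 g$ iff there is no $h$ with $(g,h)\in E$ and $(f,h)\notin E$, and $f\le_2 g$ iff there is no $h$ with $(h,g)\in E$ and $(h,f)\notin E$ (on $\mathrm{SPH}(L)$ these mean $f^{-1}(1)\subseteq g^{-1}(1)$ and $f^{-1}(0)\subseteq g^{-1}(0)$). For $A\subseteq X$ let $\ell(A)=\{f : f\not\le_1 g \text{ for all } g\in A\}$ and $r(A)=\{f : f\not\le_2 g\text{ for all } g\in A\}$; $A$ is $\ell$-stable if $\ell r(A)=A$ and $r$-stable if $r\ell(A)=A$. An $\mathcal L$-graph morphism $\alpha:X\to Y$ is a map preserving $\le_1$ and $\le_2$ such that $\alpha^{-1}(r(A))=r(\alpha^{-1}(A))$ for every $\ell$-stable $A\subseteq Y$ and $\alpha^{-1}(\ell(A))=\ell(\alpha^{-1}(A))$ for every $r$-stable $A\subseteq Y$. Let $\mathcal Y$ be the category of $\mathcal L$-graphs and $\mathcal L$-graph morphisms, $\mathcal Y_{\mathcal T}$ the category of $\mathcal L$-graphs with topology and continuous $\mathcal L$-graph morphisms, and $\flat:\mathcal Y_{\mathcal T}\to\mathcal Y$ the functor forgetting the topology. For $Y\in\mathcal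 Y$ let $\mathrm{MPE}(Y)$ be the set of maximal partial $E$-preserving maps from $Y$ to $2$ (maximal under extension). For $Y\in\mathcal Y_{\mathcal T}$ let $\mathrm{MPM}(Y)$ be the set of those partial maps $Y\to 2$ that are maximal under extension among the partial maps with closed domain that are continuous and $E$-preserving on their domain. Both sets are ordered by $\varphi\le\psi\iff\varphi^{-1}(1)\subseteq\psi^{-1}(1)$. Then: (i) The assignments $\overline{\mathrm D}(L)=(\mathrm{SPH}(L),E,\mathcal T)$, $\overline{\mathrm D}(u)=-\circ u$ and $\overline{\mathrm G}(Y)=\mathrm{MPE}(Y)$, $\overline{\mathrm G}(\alpha)=-\circ\alpha$ are well-defined contravariant functors $\overline{\mathrm D}:\mathcal L\to\mathcal Y_{\mathcal T}$ and $\overline{\mathrm G}:\mathcal Y\to\mathcal L^+$. (ii) The assignment $\overline{\mathrm E}(Y)=\mathrm{MPM}(Y)$, $\overline{\mathrm E}(\alpha)=-\circ\alpha$ is a well-defined contravariant functor $\mathcal Y_{\mathcal T}\to\mathcal L$, and, viewing $\overline{\mathrm D}$ as a functor $\mathcal L\to\mathcal Y_{\mathcal T}^{\mathrm{op}}$ and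 $\overline{\mathrm E}$ as a functor $\mathcal Y_{\mathcal T}^{\mathrm{op}}\to\mathcal L$, $\overline{\mathrm E}$ is right adjoint to $\overline{\mathrm D}$ by an adjunction whose unit at each $L$ is the evaluation map $L\to\overline{\mathrm E}\,\overline{\mathrm D}(L)$, $a\mapsto \bar e_a$, where $\bar e_a(f)=f(a)$ if $a\in\mathrm{dom}(f)$ and $\bar e_a(f)$ is undefined otherwise; each of these maps is an isomorphism. (iii) The canonical extension functor on $\mathcal L$ factorises as $\overline{\mathrm G}\circ\flat\circ\overline{\mathrm D}$. Precisely: the maps $a\mapsto\bar e_a$ form a natural family of bounded lattice embeddings $L\to\overline{\mathrm G}\,\flat\,\overline{\mathrm D}(L)$, each of which is a canonical extension of $L$, that is, a completion which is dense (every element is a join of meets and a meet of joins of elements of $L$) and compact (if $\bigwedge A\le\bigvee B$ with $A,B\subseteq L$, then $\bigwedge A'\le\bigvee B'$ for some finite $A'\subseteq A$, $B'\subseteq B$); for every homomorphism $u$ the complete homomorphism $\overline{\mathrm G}\,\flat\,\overline{\mathrm D}(u)$ equals both canonical liftings of $u$, namely $x\mapsto\bigvee\{\bigwedge\{u(a):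 a\in L,\ p\le a\} : p\le x,\ p\text{ a meet of elements of }L\}$ and $x\mapsto\bigwedge\{\bigvee\{u(a): a\in L,\ a\le q\} : q\ge x,\ q\text{ a join of elements of }L\}$; and for every functor $\Delta:\mathcal L\to\mathcal L^+$ with a natural family of embeddings $\eta_L:L\to\Delta(L)$ that are canonical extensions there is a unique natural isomorphism $\overline{\mathrm G}\circ\flat\circ\overline{\mathrm D}\cong\Delta$ carrying $\bar e_a$ to $\eta_L(a)$ for all $L$ and all $a\in L$. -/

import Mathlib

open CategoryTheory Opposite

universe u

noncomputable section

namespace LatDual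

/-! ### Partial maps into the two-element set

The two-element lattice / ordered set / discrete space is `Bool`, with `false < true`. A partial map
is a `PFun`; `s ∈ φ x` says that `φ` is defined at `x` with value `s`. -/

/-- The set `φ⁻¹(1)`. -/
def oneSet {X : Type u} (φ : X →. Bool) : Set X := {x | true ∈ φ x}

/-- The set `φ⁻¹(0)`. -/
def zeroSet {X : Type u} (φ : X →. Bool) : Set X := {x | false ∈ φ x}

/-- `ψ` extends `φ`. -/
def Extends {X : Type u} (ψ φ : X →. Bool) : Prop := ∀ x, ∀ s ∈ φ x, s ∈ ψ x

/-- The composite `φ ∘ α`, defined at exactly those `x` for which `φ` is defined at `α x`. -/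
def pcomp {X Y : Type u} (φ : Y →. Bool) (α : X → Y) : X →. Bool := fun x => φ (α x)

open Classical in
/-- The partial map with value `1` on `A` and value `0` on `B \ A`, undefined elsewhere. -/
def pairMap {X : Type u} (A B : Set X) : X →. Bool :=
  fun x => ⟨x ∈ A ∨ x ∈ B, fun _ => decide (x ∈ A)⟩

theorem true_mem_pairMap {X : Type u} {A B : Set X} {x : X} : true ∈ pairMap A B x ↔ x ∈ A := by
  simp only [pairMap, Part.mem_mk_iff, decide_eq_true_eq]
  exact ⟨fun ⟨_, h⟩ => h, fun h => ⟨Or.inl h, h⟩⟩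

theorem false_mem_pairMap {X : Type u} {A B : Set X} {x : X} :
    false ∈ pairMap A B x ↔ x ∈ B ∧ x ∉ A := by
  simp only [pairMap, Part.mem_mk_iff, decide_eq_false_iff_not]
  exact ⟨fun ⟨h, h'⟩ => ⟨h.resolve_left h', h'⟩, fun ⟨h, h'⟩ => ⟨Or.inr h, h'⟩⟩

/-! ### Maximal partial `E`-preserving maps into the two-element ordered set -/

/-- The partial map `φ` preserves `E`. -/
def EPreserving {X : Type u} (E : X → X → Prop) (φ : X →. Bool) : Prop :=
  ∀ x y, E x y → ∀ s ∈ φ x, ∀ t ∈ φ y, s ≤ t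

/-- `φ` is a maximal partial `E`-preserving map (an MPE). -/
def IsMPE {X : Type u} (E : X → X → Prop) (φ : X →. Bool) : Prop :=
  EPreserving E φ ∧ ∀ ψ, EPreserving E ψ → Extends ψ φ → ψ = φ

/-- The set of MPE's of the graph `(X, E)`. -/
def MPE {X : Type u} (E : X → X → Prop) : Type u := {φ : X →. Bool // IsMPE E φ}

/-- An MPE as an element of `MPE E`. -/
def MPE.mk {X : Type u} {E : X → X → Prop} (φ : X →. Bool) (h : IsMPE E φ) : MPE E := ⟨φ, h⟩

/-- `φ` is a partial morphism of graphs with topology into the discrete two-element ordered set: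
its domain is closed, and it is continuous and `E`-preserving on its domain. -/
def IsPartialMorphism {X : Type u} [TopologicalSpace X] (E : X → X → Prop) (φ : X →. Bool) : Prop :=
  IsClosed φ.Dom ∧ Continuous φ.asSubtype ∧ EPreserving E φ

/-- `φ` is a maximal partial morphism (an MPM). -/
def IsMPM {X : Type u} [TopologicalSpace X] (E : X → X → Prop) (φ : X →. Bool) : Prop :=
  IsPartialMorphism E φ ∧ ∀ ψ, IsPartialMorphism E ψ → Extends ψ φ → ψ = φ

/-- The set of MPM's of the graph with topology `(X, E, 𝒯)`. -/
def MPM {X : Type u} [TopologicalSpace X] (E : X → X → Prop) : Type u :=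
  {φ : X →. Bool // IsMPM E φ}

/-- An MPM as an element of `MPM E`. -/
def MPM.mk {X : Type u} [TopologicalSpace X] {E : X → X → Prop} (φ : X →. Bool) (h : IsMPM E φ) :
    MPM E := ⟨φ, h⟩

theorem EPreserving.pairMap {X : Type u} {E : X → X → Prop} {A B : Set X}
    (h : ∀ x ∈ A, ∀ y ∈ B, ¬ E x y) : EPreserving E (pairMap A B) := by
  intro x y hxy s hs t ht
  cases s
  · exact Bool.false_le t
  · cases t
    · exact absurd hxy (h x (true_mem_pairMap.1 hs) y (false_mem_pairMap.1 ht).1)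
    · exact le_rfl

theorem EPreserving.not_rel {X : Type u} {E : X → X → Prop} {φ : X →. Bool} (h : EPreserving E φ)
    {x y : X} (hx : true ∈ φ x) (hy : false ∈ φ y) : ¬ E x y :=
  fun hxy => absurd (h x y hxy true hx false hy) (by decide)

theorem extends_pairMap {X : Type u} {φ : X →. Bool} {A B : Set X} (hA : A = oneSet φ)
    (hB : zeroSet φ ⊆ B) : Extends (pairMap A B) φ := by
  subst hA
  intro x s hs
  cases s
  · exact false_mem_pairMap.2 ⟨hB hs, fun h => absurd (Part.mem_unique h hs) (by decide)⟩
  · exact true_mem_pairMap.2 hs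

/-- MPE's are ordered by inclusion of the sets `φ⁻¹(1)`. -/
instance {X : Type u} (E : X → X → Prop) : PartialOrder (MPE E) where
  le φ ψ := oneSet φ.1 ⊆ oneSet ψ.1
  le_refl _ := subset_rfl
  le_trans _ _ _ h h' := h.trans h'
  le_antisymm φ ψ h h' := by
    have h1 : oneSet φ.1 = oneSet ψ.1 := h.antisymm h'
    have hE : EPreserving E (pairMap (oneSet φ.1) (zeroSet φ.1 ∪ zeroSet ψ.1)) := by
      refine EPreserving.pairMap fun x hx y hy => hy.elim ?_ ?_
      · exact fun hy => φ.2.1.not_rel hx hy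
      · exact fun hy => ψ.2.1.not_rel (h hx) hy
    exact Subtype.ext ((φ.2.2 _ hE (extends_pairMap rfl Set.subset_union_left)).symm.trans
      (ψ.2.2 _ hE (extends_pairMap h1 Set.subset_union_right)))

theorem isClosed_of_isPartialMorphism {X : Type u} [TopologicalSpace X] {E : X → X → Prop}
    {φ : X →. Bool} (h : IsPartialMorphism E φ) (s : Bool) : IsClosed {x | s ∈ φ x} := by
  have h1 : IsClosed (φ.asSubtype ⁻¹' {s}) := (isClosed_discrete {s}).preimage h.2.1
  have h2 := h.1.isClosedEmbedding_subtypeVal.isClosedMap _ h1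
  convert h2 using 1
  ext x
  constructor
  · intro hx
    exact ⟨⟨x, (PFun.mem_dom _ _).2 ⟨s, hx⟩⟩, PFun.asSubtype_eq_of_mem hx _, rfl⟩
  · rintro ⟨⟨y, hy⟩, hs, rfl⟩
    have : φ.asSubtype ⟨y, hy⟩ = s := hs
    subst this
    exact Part.get_mem _

theorem isPartialMorphism_of_isClosed {X : Type u} [TopologicalSpace X] {E : X → X → Prop}
    {φ : X →. Bool} (h1 : IsClosed (oneSet φ)) (h0 : IsClosed (zeroSet φ)) (hE : EPreserving E φ) :
    IsPartialMorphism E φ := by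
  refine ⟨?_, ?_, hE⟩
  · convert h1.union h0 using 1
    ext x
    simp [oneSet, zeroSet, or_comm]
  · have key : ∀ s : Bool, IsClosed (φ.asSubtype ⁻¹' {s}) := by
      intro s
      have : φ.asSubtype ⁻¹' {s} = Subtype.val ⁻¹' {x | s ∈ φ x} := by
        ext ⟨x, hx⟩
        constructor
        · intro hs
          have : φ.asSubtype ⟨x, hx⟩ = s := hs
          subst this
          exact Part.get_mem _
        · exact fun hs => PFun.asSubtype_eq_of_mem hs _
      rw [this]
      cases s
      · exact h0.preimage continuous_subtype_val
      · exact h1.preimage continuous_subtype_val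
    refine continuous_iff_isClosed.2 fun S _ => ?_
    rw [← Set.biUnion_of_singleton S, Set.preimage_iUnion₂]
    exact Set.Finite.isClosed_biUnion (Set.toFinite S) fun s _ => key s

/-- MPM's are ordered by inclusion of the sets `φ⁻¹(1)`. -/
instance {X : Type u} [TopologicalSpace X] (E : X → X → Prop) : PartialOrder (MPM E) where
  le φ ψ := oneSet φ.1 ⊆ oneSet ψ.1
  le_refl _ := subset_rfl
  le_trans _ _ _ h h' := h.trans h'
  le_antisymm φ ψ h h' := by
    have h1 : oneSet φ.1 = oneSet ψ.1 := h.antisymm h'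
    have hE : IsPartialMorphism E (pairMap (oneSet φ.1) (zeroSet φ.1 ∪ zeroSet ψ.1)) := by
      refine isPartialMorphism_of_isClosed ?_ ?_ (EPreserving.pairMap fun x hx y hy => hy.elim ?_ ?_)
      · convert isClosed_of_isPartialMorphism φ.2.1 true using 1
        ext x
        exact true_mem_pairMap
      · convert (isClosed_of_isPartialMorphism φ.2.1 false).union
          (isClosed_of_isPartialMorphism ψ.2.1 false) using 1
        ext x
        refine false_mem_pairMap.trans ⟨And.left, fun hx => ⟨hx, fun hx' => hx.elim ?_ ?_⟩⟩
        · exact fun hy => absurd (Part.mem_unique hx' hy) (by decide)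
        · exact fun hy => absurd (Part.mem_unique (h hx') hy) (by decide)
      · exact fun hy => φ.2.1.2.2.not_rel hx hy
      · exact fun hy => ψ.2.1.2.2.not_rel (h hx) hy
    exact Subtype.ext ((φ.2.2 _ hE (extends_pairMap rfl Set.subset_union_left)).symm.trans
      (ψ.2.2 _ hE (extends_pairMap h1 Set.subset_union_right)))

/-! ### The dual space of special partial homomorphisms -/

/-- `f` is a partial homomorphism from `L` into the two-element bounded lattice: its domain is a
`0,1`-sublattice of `L` and it is a bounded lattice homomorphism on its domain. -/
structure IsPartialHom {L : Type u} [Lattice L] [BoundedOrder L] (f : L →. Bool) : Prop where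
  map_bot : ⊥ ∈ f ⊥
  map_top : ⊤ ∈ f ⊤
  map_sup : ∀ a b, ∀ s ∈ f a, ∀ t ∈ f b, s ⊔ t ∈ f (a ⊔ b)
  map_inf : ∀ a b, ∀ s ∈ f a, ∀ t ∈ f b, s ⊓ t ∈ f (a ⊓ b)

/-- `f` is a special partial homomorphism (an SPH): a partial homomorphism for which
`(f⁻¹(1), f⁻¹(0))` is a filter-ideal pair. -/
structure IsSPH {L : Type u} [Lattice L] [BoundedOrder L] (f : L →. Bool) : Prop
    extends IsPartialHom f where
  isPFilter : Order.IsPFilter (oneSet f)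
  isIdeal : Order.IsIdeal (zeroSet f)

/-- The set of SPH's from `L` into the two-element bounded lattice. -/
def SPH (L : BddLat.{u}) : Type u := {f : L →. Bool // IsSPH f}

/-- An SPH as an element of `SPH L`. -/
def SPH.mk {L : BddLat.{u}} (f : L →. Bool) (h : IsSPH f) : SPH L := ⟨f, h⟩

/-- The relation `E` on SPH's: `f(x) ≤ g(x)` for all `x ∈ dom f ∩ dom g`. -/
def SPH.E {L : BddLat.{u}} (f g : SPH L) : Prop := ∀ x, ∀ s ∈ f.1 x, ∀ t ∈ g.1 x, s ≤ t

/-- The topology on SPH's: the sets `V_a = {f | f(a) = 0}` and `W_a = {f | f(a) = 1}` form a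
subbasis of closed sets. -/
instance (L : BddLat.{u}) : TopologicalSpace (SPH L) :=
  TopologicalSpace.generateFrom {U | ∃ (a : L) (s : Bool), U = {f : SPH L | s ∈ f.1 a}ᶜ}

/-- The evaluation map `ē_a`, `f ↦ f(a)`, defined at those `f` with `a ∈ dom f`. -/
def evalMap {L : BddLat.{u}} (a : L) : SPH L →. Bool := fun f => f.1 a

/-! ### `𝓛`-graphs and their morphisms

On an `𝓛`-graph the two quasi-orders are recovered from `E`; see `SPH.le₁_iff`, `SPH.le₂_iff`. -/

section Graph

variable {X Y : Type u}

/-- The quasi-order `≤₁` of a graph. -/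
def le₁ (E : X → X → Prop) (f g : X) : Prop := ¬ ∃ h, E g h ∧ ¬ E f h

/-- The quasi-order `≤₂` of a graph. -/
def le₂ (E : X → X → Prop) (f g : X) : Prop := ¬ ∃ h, E h g ∧ ¬ E h f

/-- The map `ℓ` on subsets. -/
def ellMap (E : X → X → Prop) (A : Set X) : Set X := {f | ∀ g ∈ A, ¬ le₁ E f g}

/-- The map `r` on subsets. -/
def rMap (E : X → X → Prop) (A : Set X) : Set X := {f | ∀ g ∈ A, ¬ le₂ E f g}

/-- `A` is `ℓ`-stable. -/
def EllStable (E : X → X → Prop) (A : Set X) : Prop := ellMap E (rMap E A) = A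

/-- `A` is `r`-stable. -/
def RStable (E : X → X → Prop) (A : Set X) : Prop := rMap E (ellMap E A) = A

/-- `α` is an `𝓛`-graph morphism from `(X, EX)` to `(Y, EY)`. -/
structure IsLGraphMorphism (EX : X → X → Prop) (EY : Y → Y → Prop) (α : X → Y) : Prop where
  map_le₁ : ∀ f g, le₁ EX f g → le₁ EY (α f) (α g)
  map_le₂ : ∀ f g, le₂ EX f g → le₂ EY (α f) (α g)
  preimage_rMap : ∀ A, EllStable EY A → α ⁻¹' (rMap EY A) = rMap EX (α ⁻¹' A)
  preimage_ellMap : ∀ A, RStable EY A → α ⁻¹' (ellMap EY A) = ellMap EX (α ⁻¹' A)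

theorem IsLGraphMorphism.id (EX : X → X → Prop) : IsLGraphMorphism EX EX id :=
  ⟨fun _ _ h => h, fun _ _ h => h, fun _ _ => rfl, fun _ _ => rfl⟩

theorem IsLGraphMorphism.comp {Z : Type u} {EX : X → X → Prop} {EY : Y → Y → Prop}
    {EZ : Z → Z → Prop} {β : Y → Z} {α : X → Y} (hβ : IsLGraphMorphism EY EZ β)
    (hα : IsLGraphMorphism EX EY α) : IsLGraphMorphism EX EZ (β ∘ α) where
  map_le₁ f g h := hβ.map_le₁ _ _ (hα.map_le₁ _ _ h)
  map_le₂ f g h := hβ.map_le₂ _ _ (hα.map_le₂ _ _ h)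
  preimage_rMap A hA := by
    have hr : RStable EZ (rMap EZ A) := congrArg (rMap EZ) hA
    have hs : EllStable EY (β ⁻¹' A) := by
      unfold EllStable at hA ⊢
      rw [← hβ.preimage_rMap A hA, ← hβ.preimage_ellMap _ hr, hA]
    rw [Set.preimage_comp, hβ.preimage_rMap A hA, hα.preimage_rMap _ hs, Set.preimage_comp]
  preimage_ellMap A hA := by
    have hl : EllStable EZ (ellMap EZ A) := congrArg (ellMap EZ) hA
    have hs : RStable EY (β ⁻¹' A) := by
      unfold RStable at hA ⊢
      rw [← hβ.preimage_ellMap A hA, ← hβ.preimage_rMap _ hl, hA]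
    rw [Set.preimage_comp, hβ.preimage_ellMap A hA, hα.preimage_ellMap _ hs, Set.preimage_comp]

end Graph

/-- The special partial homomorphism given by a disjoint filter-ideal pair. -/
def SPH.ofPair {L : BddLat.{u}} (F I : Set L) (hF : Order.IsPFilter F) (hI : Order.IsIdeal I)
    (hFI : ∀ a ∈ F, a ∉ I) : SPH L := by
  have h1 : ∀ a, true ∈ LatDual.pairMap F I a ↔ a ∈ F := fun a => true_mem_pairMap
  have h0 : ∀ a, false ∈ LatDual.pairMap F I a ↔ a ∈ I := fun a =>
    false_mem_pairMap.trans ⟨And.left, fun h => ⟨h, fun h' => hFI a h' h⟩⟩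
  have up : ∀ {a b : L}, a ≤ b → a ∈ F → b ∈ F := fun {a b} hab ha => (hF.toPFilter).mem_of_le hab ha
  have dn : ∀ {a b : L}, a ≤ b → b ∈ I → a ∈ I := fun {a b} hab hb => hI.IsLowerSet hab hb
  have inf : ∀ {a b : L}, a ∈ F → b ∈ F → a ⊓ b ∈ F := fun {a b} ha hb =>
    Order.PFilter.inf_mem (F := hF.toPFilter) ha hb
  have sup : ∀ {a b : L}, a ∈ I → b ∈ I → a ⊔ b ∈ I := fun {a b} ha hb =>
    Order.Ideal.sup_mem (s := hI.toIdeal) ha hb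
  refine ⟨LatDual.pairMap F I, ⟨⟨?_, ?_, ?_, ?_⟩, ?_, ?_⟩⟩
  · obtain ⟨a, ha⟩ := hI.Nonempty
    exact (h0 _).2 (dn bot_le ha)
  · exact (h1 _).2 (Order.PFilter.top_mem (F := hF.toPFilter))
  · rintro a b (_ | _) hs (_ | _) ht
    · exact (h0 _).2 (sup ((h0 _).1 hs) ((h0 _).1 ht))
    · exact (h1 _).2 (up le_sup_right ((h1 _).1 ht))
    · exact (h1 _).2 (up le_sup_left ((h1 _).1 hs))
    · exact (h1 _).2 (up le_sup_left ((h1 _).1 hs))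
  · rintro a b (_ | _) hs (_ | _) ht
    · exact (h0 _).2 (dn inf_le_left ((h0 _).1 hs))
    · exact (h0 _).2 (dn inf_le_left ((h0 _).1 hs))
    · exact (h0 _).2 (dn inf_le_right ((h0 _).1 ht))
    · exact (h1 _).2 (inf ((h1 _).1 hs) ((h1 _).1 ht))
  · rwa [show oneSet (LatDual.pairMap F I) = F from Set.ext h1]
  · rwa [show zeroSet (LatDual.pairMap F I) = I from Set.ext h0]

theorem SPH.rel_iff {L : BddLat.{u}} {f g : SPH L} :
    SPH.E f g ↔ ∀ a ∈ oneSet f.1, a ∉ zeroSet g.1 := by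
  refine ⟨fun h a ha hb => absurd (h a true ha false hb) (by decide), fun h a s hs t ht => ?_⟩
  cases s
  · exact Bool.false_le t
  · cases t
    · exact absurd ht (h a hs)
    · exact le_rfl

/-- On SPH's, `f ≤₁ g` means `f⁻¹(1) ⊆ g⁻¹(1)`. -/
theorem SPH.le₁_iff {L : BddLat.{u}} {f g : SPH L} :
    le₁ SPH.E f g ↔ oneSet f.1 ⊆ oneSet g.1 := by
  constructor
  · intro h a ha
    by_contra hga
    have hd : ∀ b ∈ oneSet g.1, b ∉ Set.Iic a := fun b hb hba =>
      hga (g.2.isPFilter.toPFilter.mem_of_le hba hb)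
    refine h ⟨SPH.ofPair (oneSet g.1) (Set.Iic a) g.2.isPFilter (Order.Ideal.principal a).isIdeal hd,
      SPH.rel_iff.2 fun b hb hb' => hd b hb (false_mem_pairMap.1 hb').1,
      fun hE => SPH.rel_iff.1 hE a ha (false_mem_pairMap.2 ⟨le_rfl, hga⟩)⟩
  · rintro h ⟨k, h1, h2⟩
    exact h2 (SPH.rel_iff.2 fun a ha => SPH.rel_iff.1 h1 a (h ha))

/-- On SPH's, `f ≤₂ g` means `f⁻¹(0) ⊆ g⁻¹(0)`. -/
theorem SPH.le₂_iff {L : BddLat.{u}} {f g : SPH L} :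
    le₂ SPH.E f g ↔ zeroSet f.1 ⊆ zeroSet g.1 := by
  constructor
  · intro h a ha
    by_contra hga
    have hd : ∀ b ∈ Set.Ici a, b ∉ zeroSet g.1 := fun b hab hb => hga (g.2.isIdeal.IsLowerSet hab hb)
    refine h ⟨SPH.ofPair (Set.Ici a) (zeroSet g.1) (Order.PFilter.principal a).isPFilter
      g.2.isIdeal hd, SPH.rel_iff.2 fun b hb hb' => hd b (true_mem_pairMap.1 hb) hb',
      fun hE => SPH.rel_iff.1 hE a (true_mem_pairMap.2 le_rfl) ha⟩
  · rintro h ⟨k, h1, h2⟩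
    exact h2 (SPH.rel_iff.2 fun a ha ha' => SPH.rel_iff.1 h1 a ha (h ha'))

/-! ### The categories `𝓨` and `𝓨_𝒯` -/

/-- An `𝓛`-graph: a graph that is (isomorphic to) the graph of SPH's of some bounded lattice. -/
structure LGraph where
  carrier : Type u
  E : carrier → carrier → Prop
  isLGraph : ∃ L : BddLat.{u}, Nonempty (E ≃r (SPH.E : SPH L → SPH L → Prop))

/-- An `𝓛`-graph with topology: a graph with topology that is (isomorphic to) the dual space of
SPH's of some bounded lattice. -/
structure TopLGraph where
  carrier : Type u
  [top : TopologicalSpace carrier]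
  E : carrier → carrier → Prop
  isLGraph : ∃ (L : BddLat.{u}) (e : carrier ≃ₜ SPH L), ∀ x y, SPH.E (e x) (e y) ↔ E x y

attribute [instance] TopLGraph.top

/-- The category `𝓨` of `𝓛`-graphs and `𝓛`-graph morphisms. -/
instance : Category LGraph.{u} where
  Hom X Y := {α : X.carrier → Y.carrier // IsLGraphMorphism X.E Y.E α}
  id X := ⟨id, IsLGraphMorphism.id X.E⟩
  comp α β := ⟨β.1 ∘ α.1, β.2.comp α.2⟩

/-- The category `𝓨_𝒯` of `𝓛`-graphs with topology and continuous `𝓛`-graph morphisms. -/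
instance : Category TopLGraph.{u} where
  Hom X Y := {α : X.carrier → Y.carrier // IsLGraphMorphism X.E Y.E α ∧ Continuous α}
  id X := ⟨id, IsLGraphMorphism.id X.E, continuous_id⟩
  comp α β := ⟨β.1 ∘ α.1, β.2.1.comp α.2.1, β.2.2.comp α.2.2⟩

/-- The functor `♭ : 𝓨_𝒯 ⥤ 𝓨` forgetting the topology. -/
def flat : TopLGraph.{u} ⥤ LGraph.{u} where
  obj X := ⟨X.carrier, X.E, let ⟨L, e, he⟩ := X.isLGraph; ⟨L, ⟨e.toEquiv, he _ _⟩⟩⟩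
  map α := ⟨α.1, α.2.1⟩

/-! ### The functor `D̄`

The contravariant functors are packaged from their object maps, the action on morphisms by
composition, and a proof that this action is well defined. -/

/-- The dual space `D̄(L)`. -/
def dualSpace (L : BddLat.{u}) : TopLGraph.{u} where
  carrier := SPH L
  E := SPH.E
  isLGraph := ⟨L, Homeomorph.refl _, fun _ _ => Iff.rfl⟩

/-- `D̄` is well defined: for `u : L → K`, composition with `u` sends SPH's to SPH's and is a
continuous `𝓛`-graph morphism `D̄(K) → D̄(L)`. -/
structure DbarWellDefined : Prop where
  isSPH : ∀ {L K : BddLat.{u}} (u : L ⟶ K) (f : SPH K), IsSPH (pcomp f.1 (fun a : L => u a))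
  isMorphism : ∀ {L K : BddLat.{u}} (u : L ⟶ K),
    IsLGraphMorphism (SPH.E (L := K)) (SPH.E (L := L))
      (fun f : SPH K => SPH.mk (pcomp f.1 (fun a : L => u a)) (isSPH u f))
  continuous : ∀ {L K : BddLat.{u}} (u : L ⟶ K),
    Continuous (fun f : SPH K => SPH.mk (pcomp f.1 (fun a : L => u a)) (isSPH u f))

/-- The functor `D̄`: `L ↦ SPH(L, 2)`, `u ↦ - ∘ u`. -/
def Dbar (h : DbarWellDefined.{u}) : BddLat.{u} ⥤ TopLGraph.{u}ᵒᵖ where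
  obj L := op (dualSpace L)
  map {L K} u := Quiver.Hom.op (X := dualSpace K) (Y := dualSpace L)
    ⟨fun f => SPH.mk (pcomp f.1 (fun a : L => u a)) (h.isSPH u f), h.isMorphism u, h.continuous u⟩
  map_id _ := rfl
  map_comp _ _ := rfl

/-! ### The functor `Ḡ` -/

/-- `Ḡ` is well defined: the MPE's of an `𝓛`-graph form a complete lattice, composition with an
`𝓛`-graph morphism `α : X → Y` sends MPE's of `Y` to MPE's of `X`, and it preserves arbitrary joins
and meets. -/
structure GbarWellDefined : Prop where
  exists_isLUB : ∀ (X : LGraph.{u}) (S : Set (MPE X.E)), ∃ φ, IsLUB S φ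
  exists_isGLB : ∀ (X : LGraph.{u}) (S : Set (MPE X.E)), ∃ φ, IsGLB S φ
  isMPE : ∀ {X Y : LGraph.{u}} (α : X ⟶ Y) (φ : MPE Y.E), IsMPE X.E (pcomp φ.1 α.1)
  isLUB : ∀ {X Y : LGraph.{u}} (α : X ⟶ Y) (S : Set (MPE Y.E)) (φ : MPE Y.E), IsLUB S φ →
    IsLUB ((fun ψ : MPE Y.E => MPE.mk (pcomp ψ.1 α.1) (isMPE α ψ)) '' S)
      (MPE.mk (pcomp φ.1 α.1) (isMPE α φ))
  isGLB : ∀ {X Y : LGraph.{u}} (α : X ⟶ Y) (S : Set (MPE Y.E)) (φ : MPE Y.E), IsGLB S φ →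
    IsGLB ((fun ψ : MPE Y.E => MPE.mk (pcomp ψ.1 α.1) (isMPE α ψ)) '' S)
      (MPE.mk (pcomp φ.1 α.1) (isMPE α φ))

/-- The complete lattice of MPE's (with the order defined above). -/
abbrev GbarWellDefined.completeLattice (h : GbarWellDefined.{u}) (X : LGraph.{u}) :
    CompleteLattice (MPE X.E) :=
  letI : SupSet (MPE X.E) := ⟨fun S => (h.exists_isLUB X S).choose⟩
  completeLatticeOfSup (MPE X.E) fun S => (h.exists_isLUB X S).choose_spec

/-- The object `Ḡ(X)`. -/
def GbarObj (h : GbarWellDefined.{u}) (X : LGraph.{u}) : CompleteLat.{u} :=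
  letI := h.completeLattice X
  CompleteLat.of (MPE X.E)

/-- The functor `Ḡ`: `X ↦ MPE(X, 2)`, `α ↦ - ∘ α`. -/
def Gbar (h : GbarWellDefined.{u}) : LGraph.{u}ᵒᵖ ⥤ CompleteLat.{u} where
  obj X := GbarObj h X.unop
  map {Y X} α :=
    letI := h.completeLattice X.unop
    letI := h.completeLattice Y.unop
    ConcreteCategory.ofHom (C := CompleteLat.{u}) (X := GbarObj h Y.unop) (Y := GbarObj h X.unop)
      { toFun := fun φ : MPE Y.unop.E =>
          MPE.mk (pcomp φ.1 α.unop.1) (h.isMPE α.unop φ)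
        map_sInf' := fun S => (h.isGLB α.unop S _ (isGLB_sInf S)).unique (isGLB_sInf _)
        map_sSup' := fun S => (h.isLUB α.unop S _ (isLUB_sSup S)).unique (isLUB_sSup _) }
  map_id _ := rfl
  map_comp _ _ := rfl

/-! ### The functor `Ē` -/

/-- `Ē` is well defined: the MPM's of an `𝓛`-graph with topology form a bounded lattice, composition
with a continuous `𝓛`-graph morphism `α : X → Y` sends MPM's of `Y` to MPM's of `X`, and it is a
bounded lattice homomorphism. -/
structure EbarWellDefined : Prop where
  exists_isLUB : ∀ (X : TopLGraph.{u}) (φ ψ : MPM X.E), ∃ χ, IsLUB {φ, ψ} χ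
  exists_isGLB : ∀ (X : TopLGraph.{u}) (φ ψ : MPM X.E), ∃ χ, IsGLB {φ, ψ} χ
  exists_isTop : ∀ X : TopLGraph.{u}, ∃ φ : MPM X.E, IsTop φ
  exists_isBot : ∀ X : TopLGraph.{u}, ∃ φ : MPM X.E, IsBot φ
  isMPM : ∀ {X Y : TopLGraph.{u}} (α : X ⟶ Y) (φ : MPM Y.E), IsMPM X.E (pcomp φ.1 α.1)
  isLUB : ∀ {X Y : TopLGraph.{u}} (α : X ⟶ Y) (φ ψ χ : MPM Y.E), IsLUB {φ, ψ} χ →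
    IsLUB {MPM.mk (pcomp φ.1 α.1) (isMPM α φ), MPM.mk (pcomp ψ.1 α.1) (isMPM α ψ)}
      (MPM.mk (pcomp χ.1 α.1) (isMPM α χ))
  isGLB : ∀ {X Y : TopLGraph.{u}} (α : X ⟶ Y) (φ ψ χ : MPM Y.E), IsGLB {φ, ψ} χ →
    IsGLB {MPM.mk (pcomp φ.1 α.1) (isMPM α φ), MPM.mk (pcomp ψ.1 α.1) (isMPM α ψ)}
      (MPM.mk (pcomp χ.1 α.1) (isMPM α χ))
  isTop : ∀ {X Y : TopLGraph.{u}} (α : X ⟶ Y) (φ : MPM Y.E), IsTop φ →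
    IsTop (MPM.mk (pcomp φ.1 α.1) (isMPM α φ))
  isBot : ∀ {X Y : TopLGraph.{u}} (α : X ⟶ Y) (φ : MPM Y.E), IsBot φ →
    IsBot (MPM.mk (pcomp φ.1 α.1) (isMPM α φ))

/-- The lattice of MPM's (with the order defined above). -/
abbrev EbarWellDefined.lattice (h : EbarWellDefined.{u}) (X : TopLGraph.{u}) :
    Lattice (MPM X.E) where
  sup φ ψ := (h.exists_isLUB X φ ψ).choose
  inf φ ψ := (h.exists_isGLB X φ ψ).choose
  le_sup_left φ ψ := (h.exists_isLUB X φ ψ).choose_spec.1 (Or.inl rfl)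
  le_sup_right φ ψ := (h.exists_isLUB X φ ψ).choose_spec.1 (Or.inr rfl)
  sup_le φ ψ _ h1 h2 := (h.exists_isLUB X φ ψ).choose_spec.2
    (by rintro _ (rfl | rfl); exacts [h1, h2])
  inf_le_left φ ψ := (h.exists_isGLB X φ ψ).choose_spec.1 (Or.inl rfl)
  inf_le_right φ ψ := (h.exists_isGLB X φ ψ).choose_spec.1 (Or.inr rfl)
  le_inf _ φ ψ h1 h2 := (h.exists_isGLB X φ ψ).choose_spec.2
    (by rintro _ (rfl | rfl); exacts [h1, h2])

/-- The bounds of the lattice of MPM's. -/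
abbrev EbarWellDefined.boundedOrder (h : EbarWellDefined.{u}) (X : TopLGraph.{u}) :
    BoundedOrder (MPM X.E) where
  top := (h.exists_isTop X).choose
  bot := (h.exists_isBot X).choose
  le_top := (h.exists_isTop X).choose_spec
  bot_le := (h.exists_isBot X).choose_spec

/-- The object `Ē(X)`. -/
def EbarObj (h : EbarWellDefined.{u}) (X : TopLGraph.{u}) : BddLat.{u} :=
  letI := h.lattice X
  letI : BoundedOrder (MPM X.E) := h.boundedOrder X
  BddLat.of (MPM X.E)

/-- The functor `Ē`: `X ↦ MPM(X, 2)`, `α ↦ - ∘ α`. -/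
def Ebar (h : EbarWellDefined.{u}) : TopLGraph.{u}ᵒᵖ ⥤ BddLat.{u} where
  obj X := EbarObj h X.unop
  map {Y X} α :=
    letI := h.lattice X.unop
    letI := h.lattice Y.unop
    letI : BoundedOrder (MPM X.unop.E) := h.boundedOrder X.unop
    letI : BoundedOrder (MPM Y.unop.E) := h.boundedOrder Y.unop
    ConcreteCategory.ofHom (C := BddLat.{u}) (X := EbarObj h Y.unop) (Y := EbarObj h X.unop)
      { toFun := fun φ : MPM Y.unop.E =>
          MPM.mk (pcomp φ.1 α.unop.1) (h.isMPM α.unop φ)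
        map_sup' := fun φ ψ => (h.isLUB α.unop φ ψ _ isLUB_pair).unique isLUB_pair
        map_inf' := fun φ ψ => (h.isGLB α.unop φ ψ _ isGLB_pair).unique isGLB_pair
        map_top' := (h.isTop α.unop _ isTop_top).eq_top
        map_bot' := (h.isBot α.unop _ isBot_bot).eq_bot }
  map_id _ := rfl
  map_comp _ _ := rfl

/-! ### Canonical extensions -/

section CanonicalExtension

variable {L K C D : Type u} [Lattice L] [BoundedOrder L] [Lattice K] [BoundedOrder K]
  [CompleteLattice C] [CompleteLattice D]

/-- `p` is a filter element of the completion `(e, C)`: a meet of elements of `e(L)`. -/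
def IsFilterElement (e : L → C) (p : C) : Prop := ∃ A : Set L, p = sInf (e '' A)

/-- `q` is an ideal element of the completion `(e, C)`: a join of elements of `e(L)`. -/
def IsIdealElement (e : L → C) (q : C) : Prop := ∃ A : Set L, q = sSup (e '' A)

/-- `(e, C)` is a canonical extension of `L`: a dense and compact completion. -/
structure IsCanonicalExtension (e : BoundedLatticeHom L C) : Prop where
  injective : Function.Injective e
  exists_sSup : ∀ x : C, ∃ S : Set C, (∀ p ∈ S, IsFilterElement e p) ∧ x = sSup S
  exists_sInf : ∀ x : C, ∃ S : Set C, (∀ q ∈ S, IsIdealElement e q) ∧ x = sInf S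
  compact : ∀ A B : Set L, sInf (e '' A) ≤ sSup (e '' B) →
    ∃ A' ⊆ A, ∃ B' ⊆ B, A'.Finite ∧ B'.Finite ∧ sInf (e '' A') ≤ sSup (e '' B')

/-- The extension `u^σ` of a (monotone) map `u : L → K` to the completions `(e, C)`, `(d, D)`:
`u^σ(x) = ⋁ {⋀ {u(a) | a ∈ L, p ≤ a} | p ≤ x a filter element}`. -/
def sigmaExt (e : L → C) (d : K → D) (u : L → K) (x : C) : D :=
  sSup {y | ∃ p, IsFilterElement e p ∧ p ≤ x ∧ y = sInf {z | ∃ a, p ≤ e a ∧ z = d (u a)}}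

/-- The extension `u^π` of a (monotone) map `u : L → K` to the completions `(e, C)`, `(d, D)`:
`u^π(x) = ⋀ {⋁ {u(a) | a ∈ L, a ≤ q} | q ≥ x an ideal element}`. -/
def piExt (e : L → C) (d : K → D) (u : L → K) (x : C) : D :=
  sInf {y | ∃ q, IsIdealElement e q ∧ x ≤ q ∧ y = sSup {z | ∃ a, e a ≤ q ∧ z = d (u a)}}

end CanonicalExtension

/-- `Δ`, with the embeddings `η_L : L → Δ(L)`, is a canonical extension functor: each
`(η_L, Δ(L))` is a canonical extension of `L`. Naturality of `η` says that the complete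
homomorphism `Δ(u)` lifts the homomorphism `u`. -/
def IsCanonicalExtensionFunctor (Δ : BddLat.{u} ⥤ CompleteLat.{u})
    (η : 𝟭 BddLat.{u} ⟶ Δ ⋙ forget₂ CompleteLat.{u} BddLat.{u}) : Prop :=
  ∀ L : BddLat.{u}, IsCanonicalExtension (L := L) (C := Δ.obj L) (η.app L).hom

end LatDual

end

namespace LatDual

/-! ### Partial maps -/

/-! An SPH of `L` is the same thing as a disjoint filter-ideal pair, and `E f g` says that the
filter of `f` misses the ideal of `g`. Whenever this happens, that filter and that ideal form an SPH
themselves. This property (`IsTi`) and reflexivity are all that the order-theoretic part uses. In a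
reflexive graph the maximal partial `E`-preserving maps are the Galois-closed pairs of the relation
`¬ E` (`isMPE_iff`), so meets are intersections of the sets `φ⁻¹(1)` and joins are intersections of
the sets `φ⁻¹(0)`. By `IsTi` this polarity agrees with `ℓ` and `r` on upward closed sets
(`isMPE_iff_stable`). Hence the conditions on an `𝓛`-graph morphism say exactly what makes closed
pairs pull back to closed pairs, and preimages commute with intersections, so `Ḡ` acts by complete
homomorphisms.

With topology, ultrafilters of SPH's have limits that are computed value by value. A compactness
argument, applied twice, then finds for each partial morphism on `SPH L` one `a : L` whose
evaluation map extends it (`IsPartialMorphism.exists_extends_evalMap`). So the MPM's of the dual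
space are the evaluation maps, which makes the unit invertible. Point evaluation gives the counit.

For the canonical extension, each MPE is the join of the filter elements given by the filters of the
SPH's in its `1`-set, and dually. Compactness holds because a filter and an ideal that are disjoint
define an SPH. A complete homomorphism lifting `u` is forced to be both the `σ`- and the
`π`-extension by density. Two canonical extensions are isomorphic because compactness makes the
order between filter and ideal elements depend on `L` alone (`compareMap_le_iff`). -/

theorem true_mem_false_mem {X : Type u} {φ : X →. Bool} {x : X} (h1 : true ∈ φ x)
    (h0 : false ∈ φ x) : False :=
  absurd (Part.mem_unique h1 h0) (by decide)

theorem pfun_ext {X : Type u} {φ ψ : X →. Bool} (h1 : oneSet φ = oneSet ψ)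
    (h0 : zeroSet φ = zeroSet ψ) : φ = ψ := by
  refine PFun.ext fun x s => ?_
  cases s
  · exact Set.ext_iff.1 h0 x
  · exact Set.ext_iff.1 h1 x

theorem ePreserving_iff {X : Type u} {E : X → X → Prop} {φ : X →. Bool} :
    EPreserving E φ ↔ ∀ x ∈ oneSet φ, ∀ y ∈ zeroSet φ, ¬ E x y := by
  refine ⟨fun h x hx y hy => h.not_rel hx hy, fun h x y hxy s hs t ht => ?_⟩
  cases s
  · exact Bool.false_le t
  · cases t
    · exact absurd hxy (h x hs y ht)
    · exact le_rfl

theorem oneSet_pairMap {X : Type u} (A B : Set X) : oneSet (pairMap A B) = A :=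
  Set.ext fun _ => true_mem_pairMap

theorem zeroSet_pairMap {X : Type u} {A B : Set X} (h : ∀ x ∈ A, x ∉ B) :
    zeroSet (pairMap A B) = B :=
  Set.ext fun x => false_mem_pairMap.trans ⟨And.left, fun hB => ⟨hB, fun hA => h x hA hB⟩⟩

theorem extends_iff {X : Type u} {φ ψ : X →. Bool} :
    Extends ψ φ ↔ oneSet φ ⊆ oneSet ψ ∧ zeroSet φ ⊆ zeroSet ψ := by
  refine ⟨fun h => ⟨fun x hx => h x _ hx, fun x hx => h x _ hx⟩, fun h x s hs => ?_⟩
  cases s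
  · exact h.2 hs
  · exact h.1 hs

/-! ### Maximal partial `E`-preserving maps as polarities -/

section Graph

variable {X Y : Type u} {E : X → X → Prop}

/-- In a reflexive graph the MPE's are the Galois-closed pairs of the relation `¬ E`. -/
theorem isMPE_iff (hr : ∀ x, E x x) {φ : X →. Bool} :
    IsMPE E φ ↔ oneSet φ = {x | ∀ y ∈ zeroSet φ, ¬ E x y} ∧
      zeroSet φ = {y | ∀ x ∈ oneSet φ, ¬ E x y} := by
  constructor
  · rintro ⟨hE, hmax⟩
    have hE' := ePreserving_iff.1 hE
    constructor
    · refine Set.Subset.antisymm hE' fun x hx => ?_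
      -- Reflexivity keeps the enlarged `1`-set disjoint from the `0`-set, so the new pair really
      -- extends `φ` and maximality applies.
      have hd : ∀ z ∈ insert x (oneSet φ), z ∉ zeroSet φ := by
        rintro z (rfl | hz) hz'
        · exact hx z hz' (hr z)
        · exact true_mem_false_mem hz hz'
      have := hmax (pairMap (insert x (oneSet φ)) (zeroSet φ))
        (EPreserving.pairMap (by rintro z (rfl | hz) y hy; exacts [hx y hy, hE' z hz y hy]))
        (extends_iff.2 ⟨by rw [oneSet_pairMap]; exact Set.subset_insert _ _,
          by rw [zeroSet_pairMap hd]⟩)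
      rw [← this, oneSet_pairMap]
      exact Set.mem_insert _ _
    · refine Set.Subset.antisymm (fun y hy x hx => hE' x hx y hy) fun y hy => ?_
      have hd : ∀ z ∈ oneSet φ, z ∉ insert y (zeroSet φ) := by
        rintro z hz (rfl | hz')
        · exact hy z hz (hr z)
        · exact true_mem_false_mem hz hz'
      have := hmax (pairMap (oneSet φ) (insert y (zeroSet φ)))
        (EPreserving.pairMap (by rintro x hx z (rfl | hz); exacts [hy x hx, hE' x hx z hz]))
        (extends_iff.2 ⟨by rw [oneSet_pairMap],
          by rw [zeroSet_pairMap hd]; exact Set.subset_insert _ _⟩)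
      rw [← this, zeroSet_pairMap hd]
      exact Set.mem_insert _ _
  · rintro ⟨h1, h0⟩
    refine ⟨ePreserving_iff.2 fun x hx => (h1.subset hx :), fun ψ hψ hext => ?_⟩
    rw [ePreserving_iff] at hψ
    rw [extends_iff] at hext
    refine pfun_ext (Set.Subset.antisymm (fun x hx => ?_) hext.1)
      (Set.Subset.antisymm (fun y hy => ?_) hext.2)
    · rw [h1]
      exact fun y hy => hψ x hx y (hext.2 hy)
    · rw [h0]
      exact fun x hx => hψ x (hext.1 hx) y hy

/-- Three polars in a row equal one, so a polar together with its own polar is a closed pair.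
Reflexivity makes the two halves disjoint. -/
theorem exists_isMPE_oneSet (hr : ∀ x, E x x) (T : Set X) :
    ∃ φ : MPE E, oneSet φ.1 = {x | ∀ y ∈ T, ¬ E x y} := by
  have hd : ∀ z ∈ {x | ∀ y ∈ T, ¬ E x y}, z ∉ {y | ∀ x ∈ {x | ∀ y ∈ T, ¬ E x y}, ¬ E x y} :=
    fun z hz hz' => hz' z hz (hr z)
  refine ⟨⟨pairMap {x | ∀ y ∈ T, ¬ E x y} {y | ∀ x ∈ {x | ∀ y ∈ T, ¬ E x y}, ¬ E x y},
    (isMPE_iff hr).2 ?_⟩, oneSet_pairMap _ _⟩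
  rw [oneSet_pairMap, zeroSet_pairMap hd]
  exact ⟨Set.Subset.antisymm (fun x hx y hy => hy x hx)
    fun x hx y hy => hx y fun z hz => hz y hy, rfl⟩

theorem exists_isMPE_zeroSet (hr : ∀ x, E x x) (S : Set X) :
    ∃ φ : MPE E, zeroSet φ.1 = {y | ∀ x ∈ S, ¬ E x y} := by
  have hd : ∀ z ∈ {x | ∀ y ∈ {y | ∀ x ∈ S, ¬ E x y}, ¬ E x y}, z ∉ {y | ∀ x ∈ S, ¬ E x y} :=
    fun z hz hz' => hz z hz' (hr z)
  refine ⟨⟨pairMap {x | ∀ y ∈ {y | ∀ x ∈ S, ¬ E x y}, ¬ E x y} {y | ∀ x ∈ S, ¬ E x y},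
    (isMPE_iff hr).2 ?_⟩, zeroSet_pairMap hd⟩
  rw [oneSet_pairMap, zeroSet_pairMap hd]
  exact ⟨rfl, Set.Subset.antisymm (fun y hy x hx => hx y hy)
    fun y hy x hx => hy x fun z hz => hz x hx⟩

/-- Each half of a closed pair is the polar of the other, and polars reverse inclusion. This lets
joins be read off from `0`-sets. -/
theorem IsMPE.oneSet_subset_iff (hr : ∀ x, E x x) {φ ψ : X →. Bool} (hφ : IsMPE E φ)
    (hψ : IsMPE E ψ) : oneSet φ ⊆ oneSet ψ ↔ zeroSet ψ ⊆ zeroSet φ := by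
  rw [isMPE_iff hr] at hφ hψ
  constructor
  · intro h y hy
    rw [hφ.2]
    rw [hψ.2] at hy
    exact fun x hx => hy x (h hx)
  · intro h x hx
    rw [hψ.1]
    rw [hφ.1] at hx
    exact fun y hy => hx y (h hy)

theorem MPE.le_iff_zeroSet (hr : ∀ x, E x x) {φ ψ : MPE E} :
    φ ≤ ψ ↔ zeroSet ψ.1 ⊆ zeroSet φ.1 :=
  φ.2.oneSet_subset_iff hr ψ.2

/-- An intersection of polars is the polar of the union, here of the `0`-sets. -/
theorem MPE.exists_oneSet_eq (hr : ∀ x, E x x) (S : Set (MPE E)) :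
    ∃ φ : MPE E, oneSet φ.1 = {x | ∀ ψ ∈ S, x ∈ oneSet ψ.1} := by
  obtain ⟨χ, hχ⟩ := exists_isMPE_oneSet hr (⋃ ψ ∈ S, zeroSet ψ.1)
  refine ⟨χ, ?_⟩
  rw [hχ]
  ext x
  simp only [Set.mem_iUnion, Set.mem_ofPred_eq]
  constructor
  · intro hx ψ hψ
    rw [((isMPE_iff hr).1 ψ.2).1]
    exact fun y hy => hx y ⟨ψ, hψ, hy⟩
  · rintro hx y ⟨ψ, hψ, hy⟩
    exact (((isMPE_iff hr).1 ψ.2).1.subset (hx ψ hψ) :) y hy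

theorem MPE.exists_zeroSet_eq (hr : ∀ x, E x x) (S : Set (MPE E)) :
    ∃ φ : MPE E, zeroSet φ.1 = {x | ∀ ψ ∈ S, x ∈ zeroSet ψ.1} := by
  obtain ⟨χ, hχ⟩ := exists_isMPE_zeroSet hr (⋃ ψ ∈ S, oneSet ψ.1)
  refine ⟨χ, ?_⟩
  rw [hχ]
  ext y
  simp only [Set.mem_iUnion, Set.mem_ofPred_eq]
  constructor
  · intro hy ψ hψ
    rw [((isMPE_iff hr).1 ψ.2).2]
    exact fun x hx => hy x ⟨ψ, hψ, hx⟩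
  · rintro hy x ⟨ψ, hψ, hx⟩
    exact (((isMPE_iff hr).1 ψ.2).2.subset (hy ψ hψ) :) x hx

theorem MPE.isGLB_of_oneSet {S : Set (MPE E)} {φ : MPE E}
    (h : oneSet φ.1 = {x | ∀ ψ ∈ S, x ∈ oneSet ψ.1}) : IsGLB S φ :=
  ⟨fun ψ hψ _ hx => h.subset hx ψ hψ, fun _ hθ _ hx => h.symm.subset fun _ hψ => hθ hψ hx⟩

theorem MPE.isLUB_of_zeroSet (hr : ∀ x, E x x) {S : Set (MPE E)} {φ : MPE E}
    (h : zeroSet φ.1 = {x | ∀ ψ ∈ S, x ∈ zeroSet ψ.1}) : IsLUB S φ :=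
  ⟨fun ψ hψ => (le_iff_zeroSet hr).2 fun _ hx => h.subset hx ψ hψ,
    fun _ hθ => (le_iff_zeroSet hr).2 fun _ hx => h.symm.subset fun _ hψ =>
      (le_iff_zeroSet hr).1 (hθ hψ) hx⟩

theorem MPE.isGLB_iff (hr : ∀ x, E x x) {S : Set (MPE E)} {φ : MPE E} :
    IsGLB S φ ↔ oneSet φ.1 = {x | ∀ ψ ∈ S, x ∈ oneSet ψ.1} := by
  refine ⟨fun h => ?_, isGLB_of_oneSet⟩
  obtain ⟨χ, hχ⟩ := exists_oneSet_eq hr S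
  rw [h.unique (isGLB_of_oneSet hχ), hχ]

theorem MPE.isLUB_iff (hr : ∀ x, E x x) {S : Set (MPE E)} {φ : MPE E} :
    IsLUB S φ ↔ zeroSet φ.1 = {x | ∀ ψ ∈ S, x ∈ zeroSet ψ.1} := by
  refine ⟨fun h => ?_, isLUB_of_zeroSet hr⟩
  obtain ⟨χ, hχ⟩ := exists_zeroSet_eq hr S
  rw [h.unique (isLUB_of_zeroSet hr hχ), hχ]

/-! ### The `Ti` property and stability -/

/-- A reflexive graph in which every edge `x → y` has a point above `x` in `≤₁` and above `y`
in `≤₂`. -/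
structure IsTi (E : X → X → Prop) : Prop where
  refl : ∀ x, E x x
  exists_of_rel : ∀ {x y}, E x y → ∃ z, le₁ E x z ∧ le₂ E y z

theorem le₁_iff_forall {f g : X} : le₁ E f g ↔ ∀ h, E g h → E f h := by
  simp [le₁]

theorem le₂_iff_forall {f g : X} : le₂ E f g ↔ ∀ h, E h g → E h f := by
  simp [le₂]

/-- An edge from `x` to a point of `B` yields, by `IsTi`, a point above `x` in `≤₁` that still lies
in the up-set `B`. Conversely, `x ≤₁ y` turns the loop at `y` into an edge from `x` to `y`. -/
theorem ellMap_eq (hE : IsTi E) {B : Set X} (hB : ∀ x y, le₂ E x y → x ∈ B → y ∈ B) :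
    ellMap E B = {x | ∀ y ∈ B, ¬ E x y} := by
  ext x
  constructor
  · intro hx y hy hxy
    obtain ⟨z, hz1, hz2⟩ := hE.exists_of_rel hxy
    exact hx z (hB y z hz2 hy) hz1
  · exact fun hx y hy h => hx y hy (le₁_iff_forall.1 h y (hE.refl y))

theorem rMap_eq (hE : IsTi E) {A : Set X} (hA : ∀ x y, le₁ E x y → x ∈ A → y ∈ A) :
    rMap E A = {y | ∀ x ∈ A, ¬ E x y} := by
  ext y
  constructor
  · intro hy x hx hxy
    obtain ⟨z, hz1, hz2⟩ := hE.exists_of_rel hxy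
    exact hy z (hA x z hz1 hx) hz2
  · exact fun hy x hx h => hy x hx (le₂_iff_forall.1 h x (hE.refl x))

theorem ellMap_upward (B : Set X) {x y : X} (h : le₁ E x y) (hx : x ∈ ellMap E B) :
    y ∈ ellMap E B := fun g hg hyg =>
  hx g hg (le₁_iff_forall.2 fun k hk => le₁_iff_forall.1 h k (le₁_iff_forall.1 hyg k hk))

theorem rMap_upward (A : Set X) {x y : X} (h : le₂ E x y) (hx : x ∈ rMap E A) :
    y ∈ rMap E A := fun g hg hyg =>
  hx g hg (le₂_iff_forall.2 fun k hk => le₂_iff_forall.1 h k (le₂_iff_forall.1 hyg k hk))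

/-- Both halves are upward closed, for `≤₁` and `≤₂` respectively, so the polars of `¬ E` may be
replaced by `ℓ` and `r`, the maps that morphisms respect. -/
theorem isMPE_iff_stable (hE : IsTi E) {φ : X →. Bool} :
    IsMPE E φ ↔ oneSet φ = ellMap E (zeroSet φ) ∧ zeroSet φ = rMap E (oneSet φ) := by
  constructor
  · intro h
    obtain ⟨h1, h0⟩ := (isMPE_iff hE.refl).1 h
    rw [ellMap_eq hE, rMap_eq hE]
    · exact ⟨h1, h0⟩
    · intro x y hxy hx
      rw [h1] at hx ⊢
      exact fun z hz hyz => hx z hz (le₁_iff_forall.1 hxy z hyz)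
    · intro x y hxy hx
      rw [h0] at hx ⊢
      exact fun z hz hyz => hx z hz (le₂_iff_forall.1 hxy z hyz)
  · rintro ⟨h1, h0⟩
    have u1 : ∀ x y, le₁ E x y → x ∈ oneSet φ → y ∈ oneSet φ := fun x y hxy hx => by
      rw [h1] at hx ⊢
      exact ellMap_upward _ hxy hx
    have u0 : ∀ x y, le₂ E x y → x ∈ zeroSet φ → y ∈ zeroSet φ := fun x y hxy hx => by
      rw [h0] at hx ⊢
      exact rMap_upward _ hxy hx
    rw [isMPE_iff hE.refl, ← ellMap_eq hE u0, ← rMap_eq hE u1]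
    exact ⟨h1, h0⟩

theorem IsLGraphMorphism.isMPE_pcomp {EX : X → X → Prop} {EY : Y → Y → Prop} {α : X → Y}
    (hα : IsLGraphMorphism EX EY α) (hX : IsTi EX) (hY : IsTi EY) {φ : Y →. Bool}
    (hφ : IsMPE EY φ) : IsMPE EX (pcomp φ α) := by
  obtain ⟨h1, h0⟩ := (isMPE_iff_stable hY).1 hφ
  have s1 : EllStable EY (oneSet φ) := by unfold EllStable; rw [← h0, ← h1]
  have s0 : RStable EY (zeroSet φ) := by unfold RStable; rw [← h1, ← h0]
  refine (isMPE_iff_stable hX).2 ⟨?_, ?_⟩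
  · exact (congrArg (α ⁻¹' ·) h1).trans (hα.preimage_ellMap _ s0)
  · exact (congrArg (α ⁻¹' ·) h0).trans (hα.preimage_rMap _ s1)

/-- The quasi-orders, `ℓ` and `r` are built from `E` by quantifying over all points, and
surjectivity transports such quantifiers. Injectivity plays no role, so this covers `pointEval` as
well as the homeomorphisms onto dual spaces. -/
theorem isLGraphMorphism_of_surjective {EX : X → X → Prop} {EY : Y → Y → Prop} {α : X → Y}
    (hs : Function.Surjective α) (h : ∀ x y, EY (α x) (α y) ↔ EX x y) :
    IsLGraphMorphism EX EY α := by
  have h1 : ∀ f g, le₁ EY (α f) (α g) ↔ le₁ EX f g := fun f g => by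
    simp only [le₁_iff_forall, hs.forall, h]
  have h2 : ∀ f g, le₂ EY (α f) (α g) ↔ le₂ EX f g := fun f g => by
    simp only [le₂_iff_forall, hs.forall, h]
  refine ⟨fun f g => (h1 f g).2, fun f g => (h2 f g).2, fun A _ => ?_, fun A _ => ?_⟩
  · ext f
    simp only [rMap, Set.mem_preimage, Set.mem_ofPred_eq, hs.forall, h2]
  · ext f
    simp only [ellMap, Set.mem_preimage, Set.mem_ofPred_eq, hs.forall, h1]

theorem IsTi.of_surjective {EX : X → X → Prop} {EY : Y → Y → Prop} {α : X → Y}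
    (hs : Function.Surjective α) (h : ∀ x y, EY (α x) (α y) ↔ EX x y) (hY : IsTi EY) :
    IsTi EX := by
  refine ⟨fun x => (h x x).1 (hY.refl _), fun {x y} hxy => ?_⟩
  obtain ⟨z, hz1, hz2⟩ := hY.exists_of_rel ((h x y).2 hxy)
  obtain ⟨z, rfl⟩ := hs z
  refine ⟨z, ?_, ?_⟩
  · simpa only [le₁_iff_forall, hs.forall, h] using hz1
  · simpa only [le₂_iff_forall, hs.forall, h] using hz2

end Graph

/-! ### Special partial homomorphisms -/

section FilterIdeal

variable {L : Type u} [Lattice L] [BoundedOrder L]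

theorem isPFilter_of_inf_mem {F : Set L} (htop : ⊤ ∈ F) (hup : ∀ {a b}, a ≤ b → a ∈ F → b ∈ F)
    (hinf : ∀ {a b}, a ∈ F → b ∈ F → a ⊓ b ∈ F) : Order.IsPFilter F :=
  Order.IsPFilter.of_def ⟨⊤, htop⟩
    (fun _ ha _ hb => ⟨_, hinf ha hb, inf_le_left, inf_le_right⟩) hup

theorem isIdeal_of_sup_mem {I : Set L} (hbot : ⊥ ∈ I) (hdown : ∀ {a b}, a ≤ b → b ∈ I → a ∈ I)
    (hsup : ∀ {a b}, a ∈ I → b ∈ I → a ⊔ b ∈ I) : Order.IsIdeal I where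
  IsLowerSet := fun _ _ hab ha => hdown hab ha
  Nonempty := ⟨⊥, hbot⟩
  Directed := fun _ ha _ hb => ⟨_, hsup ha hb, le_sup_left, le_sup_right⟩

variable {f : L →. Bool}

theorem IsSPH.mem_oneSet_of_le (h : IsSPH f) {a b : L} (hab : a ≤ b) (ha : a ∈ oneSet f) :
    b ∈ oneSet f :=
  h.isPFilter.toPFilter.mem_of_le hab ha

theorem IsSPH.mem_zeroSet_of_le (h : IsSPH f) {a b : L} (hab : a ≤ b) (hb : b ∈ zeroSet f) :
    a ∈ zeroSet f :=
  h.isIdeal.IsLowerSet hab hb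

theorem IsSPH.inf_mem_oneSet_iff (h : IsSPH f) {a b : L} :
    a ⊓ b ∈ oneSet f ↔ a ∈ oneSet f ∧ b ∈ oneSet f :=
  ⟨fun hab => ⟨h.mem_oneSet_of_le inf_le_left hab, h.mem_oneSet_of_le inf_le_right hab⟩,
    fun hab => h.map_inf a b true hab.1 true hab.2⟩

theorem IsSPH.sup_mem_zeroSet_iff (h : IsSPH f) {a b : L} :
    a ⊔ b ∈ zeroSet f ↔ a ∈ zeroSet f ∧ b ∈ zeroSet f :=
  ⟨fun hab => ⟨h.mem_zeroSet_of_le le_sup_left hab, h.mem_zeroSet_of_le le_sup_right hab⟩,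
    fun hab => h.map_sup a b false hab.1 false hab.2⟩

theorem IsSPH.top_mem_oneSet (h : IsSPH f) : ⊤ ∈ oneSet f := h.map_top

theorem IsSPH.bot_mem_zeroSet (h : IsSPH f) : ⊥ ∈ zeroSet f := h.map_bot

theorem isSPH_pcomp {K : Type u} [Lattice K] [BoundedOrder K] {g : K →. Bool} (h : IsSPH g)
    (v : BoundedLatticeHom L K) : IsSPH (pcomp g v) where
  map_bot := by simpa [pcomp] using h.map_bot
  map_top := by simpa [pcomp] using h.map_top
  map_sup a b s hs t ht := by simpa [pcomp] using h.map_sup (v a) (v b) s hs t ht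
  map_inf a b s hs t ht := by simpa [pcomp] using h.map_inf (v a) (v b) s hs t ht
  isPFilter := isPFilter_of_inf_mem (by simpa [pcomp, oneSet] using h.map_top)
    (fun {a b} hab ha => h.mem_oneSet_of_le (OrderHomClass.mono v hab) ha)
    (fun {a b} ha hb => by
      simpa [pcomp, oneSet] using h.inf_mem_oneSet_iff.2 ⟨(ha : v a ∈ oneSet g), hb⟩)
  isIdeal := isIdeal_of_sup_mem (by simpa [pcomp, zeroSet] using h.map_bot)
    (fun {a b} hab ha => h.mem_zeroSet_of_le (OrderHomClass.mono v hab) ha)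
    (fun {a b} ha hb => by
      simpa [pcomp, zeroSet] using h.sup_mem_zeroSet_iff.2 ⟨(ha : v a ∈ zeroSet g), hb⟩)

end FilterIdeal

section SPH

variable {L K : BddLat.{u}}

theorem SPH.oneSet_ofPair {F I : Set L} (hF : Order.IsPFilter F) (hI : Order.IsIdeal I)
    (hFI : ∀ a ∈ F, a ∉ I) : oneSet (SPH.ofPair F I hF hI hFI).1 = F :=
  oneSet_pairMap F I

theorem SPH.zeroSet_ofPair {F I : Set L} (hF : Order.IsPFilter F) (hI : Order.IsIdeal I)
    (hFI : ∀ a ∈ F, a ∉ I) : zeroSet (SPH.ofPair F I hF hI hFI).1 = I :=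
  zeroSet_pairMap hFI

/-- The witness for an edge from `f` to `g` combines the filter of `f` with the ideal of `g`, which
the edge makes disjoint. -/
theorem SPH.isTi (L : BddLat.{u}) : IsTi (SPH.E (L := L)) where
  refl f := SPH.rel_iff.2 fun _ h1 h0 => true_mem_false_mem h1 h0
  exists_of_rel {f g} h := by
    refine ⟨SPH.ofPair _ _ f.2.isPFilter g.2.isIdeal (SPH.rel_iff.1 h), ?_, ?_⟩
    · rw [SPH.le₁_iff, SPH.oneSet_ofPair]
    · rw [SPH.le₂_iff, SPH.zeroSet_ofPair]

theorem LGraph.isTi (X : LGraph.{u}) : IsTi X.E := by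
  obtain ⟨L, ⟨e⟩⟩ := X.isLGraph
  exact IsTi.of_surjective e.surjective (fun _ _ => e.map_rel_iff) (SPH.isTi L)

theorem TopLGraph.isTi (X : TopLGraph.{u}) : IsTi X.E := by
  obtain ⟨L, e, he⟩ := X.isLGraph
  exact IsTi.of_surjective e.surjective he (SPH.isTi L)

/-- Composition with a homomorphism, as a map of SPH's. -/
def SPH.comap (v : BoundedLatticeHom L K) (f : SPH K) : SPH L := ⟨pcomp f.1 v, isSPH_pcomp f.2 v⟩

/-- The edge says that `v` maps the filter of `g` off the ideal of `f`. The ideal is a down-set, so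
the filter generated by the image misses it too; `k` is this new pair. Such lifts give the
nontrivial inclusions in the morphism conditions. -/
theorem SPH.exists_comap_le₁ (v : BoundedLatticeHom L K) {g : SPH L} {f : SPH K}
    (h : SPH.E g (SPH.comap v f)) : ∃ k : SPH K, zeroSet k.1 = zeroSet f.1 ∧
      le₁ SPH.E g (SPH.comap v k) := by
  have hF : Order.IsPFilter {b : K | ∃ a ∈ oneSet g.1, v a ≤ b} :=
    isPFilter_of_inf_mem ⟨⊤, g.2.top_mem_oneSet, le_top⟩
      (fun hab ⟨c, hc, hca⟩ => ⟨c, hc, hca.trans hab⟩)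
      (fun {a b} ⟨c, hc, hca⟩ ⟨d, hd, hdb⟩ => ⟨c ⊓ d, g.2.inf_mem_oneSet_iff.2 ⟨hc, hd⟩, by
        rw [map_inf]; exact inf_le_inf hca hdb⟩)
  have hd : ∀ b ∈ {b : K | ∃ a ∈ oneSet g.1, v a ≤ b}, b ∉ zeroSet f.1 :=
    fun b ⟨a, ha, hab⟩ hb => SPH.rel_iff.1 h a ha (f.2.mem_zeroSet_of_le hab hb)
  refine ⟨SPH.ofPair _ _ hF f.2.isIdeal hd, SPH.zeroSet_ofPair _ _ _, SPH.le₁_iff.2 fun a ha => ?_⟩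
  exact (SPH.oneSet_ofPair hF f.2.isIdeal hd).symm.subset ⟨a, ha, le_rfl⟩

theorem SPH.exists_comap_le₂ (v : BoundedLatticeHom L K) {g : SPH L} {f : SPH K}
    (h : SPH.E (SPH.comap v f) g) : ∃ k : SPH K, oneSet k.1 = oneSet f.1 ∧
      le₂ SPH.E g (SPH.comap v k) := by
  have hI : Order.IsIdeal {b : K | ∃ a ∈ zeroSet g.1, b ≤ v a} :=
    isIdeal_of_sup_mem ⟨⊥, g.2.bot_mem_zeroSet, bot_le⟩
      (fun hab ⟨c, hc, hca⟩ => ⟨c, hc, hab.trans hca⟩)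
      (fun {a b} ⟨c, hc, hca⟩ ⟨d, hd, hdb⟩ => ⟨c ⊔ d, g.2.sup_mem_zeroSet_iff.2 ⟨hc, hd⟩, by
        rw [map_sup]; exact sup_le_sup hca hdb⟩)
  have hd : ∀ b ∈ oneSet f.1, b ∉ {b : K | ∃ a ∈ zeroSet g.1, b ≤ v a} :=
    fun b hb ⟨a, ha, hab⟩ => SPH.rel_iff.1 h a (f.2.mem_oneSet_of_le hab hb) ha
  refine ⟨SPH.ofPair _ _ f.2.isPFilter hI hd, SPH.oneSet_ofPair _ _ _,
    SPH.le₂_iff.2 fun a ha => ?_⟩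
  exact (SPH.zeroSet_ofPair f.2.isPFilter hI hd).symm.subset ⟨a, ha, le_rfl⟩

theorem SPH.isLGraphMorphism_comap (v : BoundedLatticeHom L K) :
    IsLGraphMorphism (SPH.E (L := K)) (SPH.E (L := L)) (SPH.comap v) where
  map_le₁ f g h := SPH.le₁_iff.2 fun a ha => SPH.le₁_iff.1 h (ha : v a ∈ oneSet f.1)
  map_le₂ f g h := SPH.le₂_iff.2 fun a ha => SPH.le₂_iff.1 h (ha : v a ∈ zeroSet f.1)
  preimage_rMap A hA := by
    -- Stability of `A` is used only through upward closure.
    have hup : ∀ x y, le₁ SPH.E x y → x ∈ A → y ∈ A := fun x y hxy hx => by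
      rw [← hA] at hx ⊢
      exact ellMap_upward _ hxy hx
    ext f
    rw [rMap_eq (SPH.isTi L) hup]
    constructor
    · intro hf g hg hfg
      refine hf _ hg (SPH.rel_iff.2 fun a ha ha' => ?_)
      exact true_mem_false_mem ha (SPH.le₂_iff.1 hfg (ha' : v a ∈ zeroSet f.1))
    · intro hf g hg hgf
      obtain ⟨k, hk, hk'⟩ := SPH.exists_comap_le₁ v hgf
      exact hf k (hup _ _ hk' hg) (SPH.le₂_iff.2 hk.symm.subset)
  preimage_ellMap A hA := by
    have hup : ∀ x y, le₂ SPH.E x y → x ∈ A → y ∈ A := fun x y hxy hx => by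
      rw [← hA] at hx ⊢
      exact rMap_upward _ hxy hx
    ext f
    rw [ellMap_eq (SPH.isTi L) hup]
    constructor
    · intro hf g hg hfg
      refine hf _ hg (SPH.rel_iff.2 fun a ha ha' => ?_)
      exact true_mem_false_mem (SPH.le₁_iff.1 hfg (ha : v a ∈ oneSet f.1)) ha'
    · intro hf g hg hgf
      obtain ⟨k, hk, hk'⟩ := SPH.exists_comap_le₂ v hgf
      exact hf k (hup _ _ hk' hg) (SPH.le₁_iff.2 hk.symm.subset)

theorem SPH.isClosed_mem (a : L) (s : Bool) : IsClosed {f : SPH L | s ∈ f.1 a} :=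
  ⟨TopologicalSpace.isOpen_generateFrom_of_mem ⟨a, s, rfl⟩⟩

theorem SPH.continuous_comap (v : BoundedLatticeHom L K) : Continuous (SPH.comap v) := by
  refine continuous_generateFrom_iff.2 ?_
  rintro _ ⟨a, s, rfl⟩
  exact (SPH.isClosed_mem (v a) s).isOpen_compl

end SPH

/-! ### Well-definedness of `D̄` and `Ḡ` -/

theorem dbarWellDefined : DbarWellDefined.{u} where
  isSPH v f := isSPH_pcomp f.2 v.hom
  isMorphism v := SPH.isLGraphMorphism_comap v.hom
  continuous v := SPH.continuous_comap v.hom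

theorem gbarWellDefined : GbarWellDefined.{u} where
  exists_isLUB X S := (MPE.exists_zeroSet_eq X.isTi.refl S).imp
    fun _ => MPE.isLUB_of_zeroSet X.isTi.refl
  exists_isGLB X S := (MPE.exists_oneSet_eq X.isTi.refl S).imp fun _ => MPE.isGLB_of_oneSet
  isMPE {X Y} α φ := α.2.isMPE_pcomp X.isTi Y.isTi φ.2
  isLUB {X Y} α S φ h := by
    refine MPE.isLUB_of_zeroSet X.isTi.refl ?_
    ext x
    simp only [Set.forall_mem_image]
    exact Set.ext_iff.1 ((MPE.isLUB_iff Y.isTi.refl).1 h) (α.1 x)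
  isGLB {X Y} α S φ h := by
    refine MPE.isGLB_of_oneSet ?_
    ext x
    simp only [Set.forall_mem_image]
    exact Set.ext_iff.1 ((MPE.isGLB_iff Y.isTi.refl).1 h) (α.1 x)

/-! ### Evaluation maps -/

section Eval

variable {L : BddLat.{u}}

theorem isMPE_evalMap (a : L) : IsMPE SPH.E (evalMap a) := by
  refine (isMPE_iff (SPH.isTi L).refl).2 ⟨?_, ?_⟩
  · refine Set.Subset.antisymm (fun f hf g hg h => SPH.rel_iff.1 h a hf hg) fun f hf => ?_
    by_contra hfa
    have hd : ∀ b ∈ oneSet f.1, b ∉ Set.Iic a := fun b hb hba => hfa (f.2.mem_oneSet_of_le hba hb)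
    have hI : Order.IsIdeal (Set.Iic a) := (Order.Ideal.principal a).isIdeal
    -- If `a` is not in the filter of `f`, pairing that filter with the principal ideal of `a` gives
    -- a point with value `0` at `a` that receives an edge from `f`.
    refine hf (SPH.ofPair _ _ f.2.isPFilter hI hd) ?_ (SPH.rel_iff.2 ?_)
    · exact (SPH.zeroSet_ofPair f.2.isPFilter hI hd).symm.subset (le_refl a)
    · rwa [SPH.zeroSet_ofPair]
  · refine Set.Subset.antisymm (fun g hg f hf h => SPH.rel_iff.1 h a hf hg) fun f hf => ?_
    by_contra hfa
    have hd : ∀ b ∈ Set.Ici a, b ∉ zeroSet f.1 := fun b hb hba => hfa (f.2.mem_zeroSet_of_le hb hba)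
    have hF : Order.IsPFilter (Set.Ici a) := (Order.PFilter.principal a).isPFilter
    refine hf (SPH.ofPair _ _ hF f.2.isIdeal hd) ?_ (SPH.rel_iff.2 ?_)
    · exact (SPH.oneSet_ofPair hF f.2.isIdeal hd).symm.subset (le_refl a)
    · rwa [SPH.oneSet_ofPair]

theorem oneSet_evalMap_subset_iff {a b : L} :
    oneSet (evalMap a) ⊆ oneSet (evalMap b) ↔ a ≤ b := by
  refine ⟨fun h => ?_, fun h f hf => f.2.mem_oneSet_of_le h hf⟩
  by_contra hab
  have hd : ∀ c ∈ Set.Ici a, c ∉ Set.Iic b := fun c hac hcb => hab (le_trans hac hcb)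
  have hF : Order.IsPFilter (Set.Ici a) := (Order.PFilter.principal a).isPFilter
  have hI : Order.IsIdeal (Set.Iic b) := (Order.Ideal.principal b).isIdeal
  exact true_mem_false_mem (h ((SPH.oneSet_ofPair hF hI hd).symm.subset (le_refl a)))
    ((SPH.zeroSet_ofPair hF hI hd).symm.subset (le_refl b))

theorem IsMPE.isMPM {X : Type u} [TopologicalSpace X] {E : X → X → Prop} {φ : X →. Bool}
    (h : IsMPE E φ) (h1 : IsClosed (oneSet φ)) (h0 : IsClosed (zeroSet φ)) : IsMPM E φ :=
  ⟨isPartialMorphism_of_isClosed h1 h0 h.1, fun ψ hψ hext => h.2 ψ hψ.2.2 hext⟩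

theorem isMPM_evalMap (a : L) : IsMPM SPH.E (evalMap a) :=
  (isMPE_evalMap a).isMPM (SPH.isClosed_mem a true) (SPH.isClosed_mem a false)

/-- An ultrafilter of SPH's converges to a limit whose filter and ideal consist of the elements
that eventually take the value `1`, respectively `0`. -/
theorem SPH.exists_ultrafilter_le_nhds (U : Ultrafilter (SPH L)) :
    ∃ z : SPH L, (U : Filter (SPH L)) ≤ nhds z ∧
      oneSet z.1 = {a | ∀ᶠ f in (U : Filter (SPH L)), a ∈ oneSet f.1} ∧
      zeroSet z.1 = {a | ∀ᶠ f in (U : Filter (SPH L)), a ∈ zeroSet f.1} := by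
  have hF : Order.IsPFilter {a : L | ∀ᶠ f in (U : Filter (SPH L)), a ∈ oneSet f.1} :=
    isPFilter_of_inf_mem (Filter.Eventually.of_forall fun f => f.2.top_mem_oneSet)
      (fun hab ha => ha.mono fun f hf => f.2.mem_oneSet_of_le hab hf)
      (fun ha hb => (ha.and hb).mono fun f hf => f.2.inf_mem_oneSet_iff.2 hf)
  have hI : Order.IsIdeal {a : L | ∀ᶠ f in (U : Filter (SPH L)), a ∈ zeroSet f.1} :=
    isIdeal_of_sup_mem (Filter.Eventually.of_forall fun f => f.2.bot_mem_zeroSet)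
      (fun hab ha => ha.mono fun f hf => f.2.mem_zeroSet_of_le hab hf)
      (fun ha hb => (ha.and hb).mono fun f hf => f.2.sup_mem_zeroSet_iff.2 hf)
  have hd : ∀ a ∈ {a : L | ∀ᶠ f in (U : Filter (SPH L)), a ∈ oneSet f.1},
      a ∉ {a : L | ∀ᶠ f in (U : Filter (SPH L)), a ∈ zeroSet f.1} :=
    fun a h1 h0 => by
      obtain ⟨f, hf1, hf0⟩ := (Filter.Eventually.and h1 h0).exists
      exact true_mem_false_mem hf1 hf0
  refine ⟨SPH.ofPair _ _ hF hI hd, ?_, SPH.oneSet_ofPair hF hI hd, SPH.zeroSet_ofPair hF hI hd⟩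
  rw [TopologicalSpace.nhds_generateFrom]
  refine le_iInf₂ fun s hs => ?_
  obtain ⟨hz, a, t, rfl⟩ := hs
  -- If the subbasic open set were not in `U`, its closed complement would be, and by construction
  -- the limit would then lie in that complement.
  rw [Filter.le_principal_iff, Ultrafilter.mem_coe, Ultrafilter.compl_mem_iff_notMem]
  intro hU
  refine hz ?_
  cases t
  · exact (SPH.zeroSet_ofPair hF hI hd).symm.subset hU
  · exact (SPH.oneSet_ofPair hF hI hd).symm.subset hU

/-- If no single `a` works, the nonempty sets of `f ∈ A` without value `1` at `a` are directed as
`a` runs through the ideal, so some ultrafilter contains them all; its limit `z` lies in the closed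
set `A`. The sets of `f` with value `1` at `a` are closed rather than open, so a bare subcover
argument does not apply. What matters is that value `1` at the chosen limit means value `1`
eventually. -/
theorem SPH.exists_mem_forall_oneSet {A : Set (SPH L)} (hA : IsClosed A) {I : Set L}
    (hI : Order.IsIdeal I) (h : ∀ f ∈ A, ∃ a ∈ I, a ∈ oneSet f.1) :
    ∃ a ∈ I, ∀ f ∈ A, a ∈ oneSet f.1 := by
  by_contra! hne
  have : Nonempty I := hI.Nonempty.to_subtype
  have hdir : Directed (· ≥ ·) fun a : I => Filter.principal {f | f ∈ A ∧ a.1 ∉ oneSet f.1} := by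
    intro a b
    obtain ⟨c, hc, hac, hbc⟩ := hI.Directed _ a.2 _ b.2
    exact ⟨⟨c, hc⟩, Filter.principal_mono.2 fun f hf =>
        ⟨hf.1, fun hfa => hf.2 (f.2.mem_oneSet_of_le hac hfa)⟩,
      Filter.principal_mono.2 fun f hf => ⟨hf.1, fun hfb => hf.2 (f.2.mem_oneSet_of_le hbc hfb)⟩⟩
  have := Filter.iInf_neBot_of_directed' hdir fun a =>
    Filter.principal_neBot_iff.2 (hne a.1 a.2)
  obtain ⟨U, hU⟩ := Ultrafilter.exists_le
    (⨅ a : I, Filter.principal {f | f ∈ A ∧ a.1 ∉ oneSet f.1})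
  have hU' : ∀ a : I, ∀ᶠ f in (U : Filter (SPH L)), f ∈ A ∧ a.1 ∉ oneSet f.1 := fun a =>
    Filter.le_principal_iff.1 (hU.trans (iInf_le _ a))
  obtain ⟨z, hUz, hz, -⟩ := SPH.exists_ultrafilter_le_nhds U
  have hzA : z ∈ A := isClosed_iff_ultrafilter.1 hA z U hUz
    ((hU' (Classical.arbitrary I)).mono fun _ hf => hf.1)
  obtain ⟨a, haI, haz⟩ := h z hzA
  rw [hz] at haz
  obtain ⟨f, hf, hfU⟩ := (haz.and (hU' ⟨a, haI⟩)).exists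
  exact hfU.2 hf

theorem SPH.exists_mem_forall_zeroSet {B : Set (SPH L)} (hB : IsClosed B) {F : Set L}
    (hF : Order.IsPFilter F) (h : ∀ f ∈ B, ∃ a ∈ F, a ∈ zeroSet f.1) :
    ∃ a ∈ F, ∀ f ∈ B, a ∈ zeroSet f.1 := by
  by_contra! hne
  have hF' : (F : Set L).Nonempty := hF.Nonempty
  have : Nonempty F := hF'.to_subtype
  have hdir : Directed (· ≥ ·) fun a : F => Filter.principal {f | f ∈ B ∧ a.1 ∉ zeroSet f.1} := by
    intro a b
    obtain ⟨c, hc, hac, hbc⟩ := hF.Directed _ a.2 _ b.2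
    exact ⟨⟨c, hc⟩, Filter.principal_mono.2 fun f hf =>
        ⟨hf.1, fun hfa => hf.2 (f.2.mem_zeroSet_of_le hac hfa)⟩,
      Filter.principal_mono.2 fun f hf => ⟨hf.1, fun hfb => hf.2 (f.2.mem_zeroSet_of_le hbc hfb)⟩⟩
  have := Filter.iInf_neBot_of_directed' hdir fun a =>
    Filter.principal_neBot_iff.2 (hne a.1 a.2)
  obtain ⟨U, hU⟩ := Ultrafilter.exists_le
    (⨅ a : F, Filter.principal {f | f ∈ B ∧ a.1 ∉ zeroSet f.1})
  have hU' : ∀ a : F, ∀ᶠ f in (U : Filter (SPH L)), f ∈ B ∧ a.1 ∉ zeroSet f.1 := fun a =>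
    Filter.le_principal_iff.1 (hU.trans (iInf_le _ a))
  obtain ⟨z, hUz, -, hz⟩ := SPH.exists_ultrafilter_le_nhds U
  have hzB : z ∈ B := isClosed_iff_ultrafilter.1 hB z U hUz
    ((hU' (Classical.arbitrary F)).mono fun _ hf => hf.1)
  obtain ⟨a, haF, haz⟩ := h z hzB
  rw [hz] at haz
  obtain ⟨f, hf, hfU⟩ := (haz.and (hU' ⟨a, haF⟩)).exists
  exact hfU.2 hf

/-- Every partial morphism on the dual space extends to an evaluation map. -/
theorem IsPartialMorphism.exists_extends_evalMap {φ : SPH L →. Bool}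
    (h : IsPartialMorphism SPH.E φ) : ∃ a, Extends (evalMap a) φ := by
  have hE := ePreserving_iff.1 h.2.2
  have hF : Order.IsPFilter {a : L | ∀ f ∈ oneSet φ, a ∈ oneSet f.1} :=
    isPFilter_of_inf_mem (fun f _ => f.2.top_mem_oneSet)
      (fun hab ha f hf => f.2.mem_oneSet_of_le hab (ha f hf))
      (fun ha hb f hf => f.2.inf_mem_oneSet_iff.2 ⟨ha f hf, hb f hf⟩)
  -- Compactness is used twice. For fixed `g` in the `0`-set, the inner use finds one `a` in the
  -- ideal of `g` with value `1` on all of `oneSet φ`. The outer use makes `a` independent of `g`.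
  obtain ⟨a, ha1, ha0⟩ := SPH.exists_mem_forall_zeroSet (isClosed_of_isPartialMorphism h false) hF
    fun g hg => by
      obtain ⟨a, ha, ha'⟩ := SPH.exists_mem_forall_oneSet (isClosed_of_isPartialMorphism h true)
        g.2.isIdeal fun f hf => by
          have := hE f hf g hg
          rw [SPH.rel_iff] at this
          push Not at this
          exact this.imp fun _ => And.symm
      exact ⟨a, ha', ha⟩
  exact ⟨a, extends_iff.2 ⟨ha1, ha0⟩⟩

end Eval

/-! ### Maximal partial morphisms on `𝓛`-graphs with topology -/

section MPM

variable {X : TopLGraph.{u}} {L : BddLat.{u}}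

theorem isMPM_pcomp_evalMap (e : X.carrier ≃ₜ SPH L) (he : ∀ x y, SPH.E (e x) (e y) ↔ X.E x y)
    (a : L) : IsMPM X.E (pcomp (evalMap a) e) :=
  ((isLGraphMorphism_of_surjective e.surjective he).isMPE_pcomp X.isTi (SPH.isTi L)
    (isMPE_evalMap a)).isMPM ((SPH.isClosed_mem a true).preimage e.continuous)
      ((SPH.isClosed_mem a false).preimage e.continuous)

/-- Transported along `e`, the map extends to an evaluation map, which is itself a partial morphism;
maximality gives equality. -/
theorem IsMPM.exists_eq_evalMap (e : X.carrier ≃ₜ SPH L)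
    (he : ∀ x y, SPH.E (e x) (e y) ↔ X.E x y) {φ : X.carrier →. Bool} (hφ : IsMPM X.E φ) :
    ∃ a, φ = pcomp (evalMap a) e := by
  have hp : IsPartialMorphism SPH.E (pcomp φ e.symm) := by
    refine isPartialMorphism_of_isClosed
      ((isClosed_of_isPartialMorphism hφ.1 true).preimage e.symm.continuous)
      ((isClosed_of_isPartialMorphism hφ.1 false).preimage e.symm.continuous)
      fun f g hfg => hφ.1.2.2 _ _ ((he _ _).1 ?_)
    rwa [e.apply_symm_apply, e.apply_symm_apply]
  obtain ⟨a, ha⟩ := hp.exists_extends_evalMap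
  refine ⟨a, (hφ.2 _ (isMPM_pcomp_evalMap e he a).1 fun x s hs => ha (e x) s ?_).symm⟩
  simpa [pcomp] using hs

/-- Maximality among continuous maps with closed domain implies maximality among all `E`-preserving
maps, because evaluation maps have the latter. The closed-pair description thus becomes available
for MPM's. -/
theorem IsMPM.isMPE {φ : X.carrier →. Bool} (hφ : IsMPM X.E φ) : IsMPE X.E φ := by
  obtain ⟨L, e, he⟩ := X.isLGraph
  obtain ⟨a, rfl⟩ := hφ.exists_eq_evalMap e he
  exact (isLGraphMorphism_of_surjective e.surjective he).isMPE_pcomp X.isTi (SPH.isTi L)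
    (isMPE_evalMap a)

theorem MPM.le_iff_zeroSet {φ ψ : MPM X.E} : φ ≤ ψ ↔ zeroSet ψ.1 ⊆ zeroSet φ.1 :=
  φ.2.isMPE.oneSet_subset_iff X.isTi.refl ψ.2.isMPE

/-- The MPE with this `0`-set has a `1`-set whose closedness is not evident from the polarity;
realising it as evaluation at `a ⊔ b` settles this. -/
theorem MPM.exists_zeroSet_eq_inter (φ ψ : MPM X.E) :
    ∃ χ : MPM X.E, zeroSet χ.1 = zeroSet φ.1 ∩ zeroSet ψ.1 := by
  obtain ⟨L, e, he⟩ := X.isLGraph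
  obtain ⟨a, ha⟩ := φ.2.exists_eq_evalMap e he
  obtain ⟨b, hb⟩ := ψ.2.exists_eq_evalMap e he
  refine ⟨⟨_, isMPM_pcomp_evalMap e he (a ⊔ b)⟩, ?_⟩
  rw [ha, hb]
  exact Set.ext fun x => (e x).2.sup_mem_zeroSet_iff

theorem MPM.exists_oneSet_eq_inter (φ ψ : MPM X.E) :
    ∃ χ : MPM X.E, oneSet χ.1 = oneSet φ.1 ∩ oneSet ψ.1 := by
  obtain ⟨L, e, he⟩ := X.isLGraph
  obtain ⟨a, ha⟩ := φ.2.exists_eq_evalMap e he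
  obtain ⟨b, hb⟩ := ψ.2.exists_eq_evalMap e he
  refine ⟨⟨_, isMPM_pcomp_evalMap e he (a ⊓ b)⟩, ?_⟩
  rw [ha, hb]
  exact Set.ext fun x => (e x).2.inf_mem_oneSet_iff

theorem MPM.exists_zeroSet_eq_empty (X : TopLGraph.{u}) : ∃ χ : MPM X.E, zeroSet χ.1 = ∅ := by
  obtain ⟨L, e, he⟩ := X.isLGraph
  exact ⟨⟨_, isMPM_pcomp_evalMap e he ⊤⟩,
    Set.eq_empty_of_forall_notMem fun x hx => true_mem_false_mem (e x).2.top_mem_oneSet hx⟩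

theorem MPM.exists_oneSet_eq_empty (X : TopLGraph.{u}) : ∃ χ : MPM X.E, oneSet χ.1 = ∅ := by
  obtain ⟨L, e, he⟩ := X.isLGraph
  exact ⟨⟨_, isMPM_pcomp_evalMap e he ⊥⟩,
    Set.eq_empty_of_forall_notMem fun x hx => true_mem_false_mem hx (e x).2.bot_mem_zeroSet⟩

theorem MPM.isLUB_of_zeroSet {φ ψ χ : MPM X.E} (h : zeroSet χ.1 = zeroSet φ.1 ∩ zeroSet ψ.1) :
    IsLUB {φ, ψ} χ := by
  refine ⟨?_, fun θ hθ => le_iff_zeroSet.2 ?_⟩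
  · rintro _ (rfl | rfl)
    · exact le_iff_zeroSet.2 (h.trans_subset Set.inter_subset_left)
    · exact le_iff_zeroSet.2 (h.trans_subset Set.inter_subset_right)
  · rw [h]
    exact Set.subset_inter (le_iff_zeroSet.1 (hθ (Or.inl rfl))) (le_iff_zeroSet.1 (hθ (Or.inr rfl)))

theorem MPM.isGLB_of_oneSet {φ ψ χ : MPM X.E} (h : oneSet χ.1 = oneSet φ.1 ∩ oneSet ψ.1) :
    IsGLB {φ, ψ} χ := by
  refine ⟨?_, fun θ hθ => show oneSet θ.1 ⊆ _ from ?_⟩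
  · rintro _ (rfl | rfl)
    · exact h.trans_subset Set.inter_subset_left
    · exact h.trans_subset Set.inter_subset_right
  · rw [h]
    exact Set.subset_inter (hθ (Or.inl rfl)) (hθ (Or.inr rfl))

theorem MPM.isTop_of_zeroSet {χ : MPM X.E} (h : zeroSet χ.1 = ∅) : IsTop χ := fun _ =>
  le_iff_zeroSet.2 (h.trans_subset (Set.empty_subset _))

theorem MPM.isBot_of_oneSet {χ : MPM X.E} (h : oneSet χ.1 = ∅) : IsBot χ := fun _ =>
  h.trans_subset (Set.empty_subset _)

theorem MPM.isLUB_iff {φ ψ χ : MPM X.E} :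
    IsLUB {φ, ψ} χ ↔ zeroSet χ.1 = zeroSet φ.1 ∩ zeroSet ψ.1 := by
  refine ⟨fun h => ?_, isLUB_of_zeroSet⟩
  obtain ⟨θ, hθ⟩ := exists_zeroSet_eq_inter φ ψ
  rw [h.unique (isLUB_of_zeroSet hθ), hθ]

theorem MPM.isGLB_iff {φ ψ χ : MPM X.E} :
    IsGLB {φ, ψ} χ ↔ oneSet χ.1 = oneSet φ.1 ∩ oneSet ψ.1 := by
  refine ⟨fun h => ?_, isGLB_of_oneSet⟩
  obtain ⟨θ, hθ⟩ := exists_oneSet_eq_inter φ ψ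
  rw [h.unique (isGLB_of_oneSet hθ), hθ]

theorem MPM.isTop_iff {χ : MPM X.E} : IsTop χ ↔ zeroSet χ.1 = ∅ := by
  refine ⟨fun h => ?_, isTop_of_zeroSet⟩
  obtain ⟨θ, hθ⟩ := exists_zeroSet_eq_empty X
  exact Set.subset_eq_empty (le_iff_zeroSet.1 (h θ)) hθ

theorem MPM.isBot_iff {χ : MPM X.E} : IsBot χ ↔ oneSet χ.1 = ∅ := by
  refine ⟨fun h => ?_, isBot_of_oneSet⟩
  obtain ⟨θ, hθ⟩ := exists_oneSet_eq_empty X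
  exact Set.subset_eq_empty (h θ) hθ

end MPM

theorem ebarWellDefined : EbarWellDefined.{u} where
  exists_isLUB _ φ ψ := (MPM.exists_zeroSet_eq_inter φ ψ).imp fun _ => MPM.isLUB_of_zeroSet
  exists_isGLB _ φ ψ := (MPM.exists_oneSet_eq_inter φ ψ).imp fun _ => MPM.isGLB_of_oneSet
  exists_isTop X := (MPM.exists_zeroSet_eq_empty X).imp fun _ => MPM.isTop_of_zeroSet
  exists_isBot X := (MPM.exists_oneSet_eq_empty X).imp fun _ => MPM.isBot_of_oneSet
  isMPM {X Y} α φ := (α.2.1.isMPE_pcomp X.isTi Y.isTi φ.2.isMPE).isMPM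
    ((isClosed_of_isPartialMorphism φ.2.1 true).preimage α.2.2)
    ((isClosed_of_isPartialMorphism φ.2.1 false).preimage α.2.2)
  isLUB α _ _ _ h := MPM.isLUB_of_zeroSet (congrArg (α.1 ⁻¹' ·) (MPM.isLUB_iff.1 h))
  isGLB α _ _ _ h := MPM.isGLB_of_oneSet (congrArg (α.1 ⁻¹' ·) (MPM.isGLB_iff.1 h))
  isTop α _ h := MPM.isTop_of_zeroSet (congrArg (α.1 ⁻¹' ·) (MPM.isTop_iff.1 h))
  isBot α _ h := MPM.isBot_of_oneSet (congrArg (α.1 ⁻¹' ·) (MPM.isBot_iff.1 h))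

/-! ### The adjunction -/

section Adjunction

theorem zeroSet_evalMap_sup {L : BddLat.{u}} (a b : L) :
    zeroSet (evalMap (a ⊔ b)) = zeroSet (evalMap a) ∩ zeroSet (evalMap b) :=
  Set.ext fun f => f.2.sup_mem_zeroSet_iff

theorem oneSet_evalMap_inf {L : BddLat.{u}} (a b : L) :
    oneSet (evalMap (a ⊓ b)) = oneSet (evalMap a) ∩ oneSet (evalMap b) :=
  Set.ext fun f => f.2.inf_mem_oneSet_iff

theorem zeroSet_evalMap_top (L : BddLat.{u}) : zeroSet (evalMap (⊤ : L)) = ∅ :=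
  Set.eq_empty_of_forall_notMem fun f hf => true_mem_false_mem f.2.top_mem_oneSet hf

theorem oneSet_evalMap_bot (L : BddLat.{u}) : oneSet (evalMap (⊥ : L)) = ∅ :=
  Set.eq_empty_of_forall_notMem fun f hf => true_mem_false_mem hf f.2.bot_mem_zeroSet

/-- The evaluation homomorphism `L ⟶ Ē(D̄(L))`. -/
noncomputable def evalHom (L : BddLat.{u}) : L ⟶ EbarObj ebarWellDefined (dualSpace L) :=
  letI := ebarWellDefined.lattice (dualSpace L)
  letI : BoundedOrder (MPM (dualSpace L).E) := ebarWellDefined.boundedOrder (dualSpace L)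
  ConcreteCategory.ofHom (C := BddLat.{u}) (X := L) (Y := EbarObj ebarWellDefined (dualSpace L))
    { toFun := fun a => (MPM.mk (evalMap a) (isMPM_evalMap a) : MPM (dualSpace L).E)
      map_sup' := fun a b => (MPM.isLUB_of_zeroSet (X := dualSpace L)
        (zeroSet_evalMap_sup a b)).unique isLUB_pair
      map_inf' := fun a b => (MPM.isGLB_of_oneSet (X := dualSpace L)
        (oneSet_evalMap_inf a b)).unique isGLB_pair
      map_top' := (MPM.isTop_of_zeroSet (X := dualSpace L) (zeroSet_evalMap_top L)).eq_top
      map_bot' := (MPM.isBot_of_oneSet (X := dualSpace L) (oneSet_evalMap_bot L)).eq_bot }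

/-- Binary meets of MPM's intersect `1`-sets and binary joins intersect `0`-sets, so the MPM's with
value `1` at `x` form a filter and those with value `0` an ideal. -/
theorem isSPH_eval (X : TopLGraph.{u}) (x : X.carrier) :
    IsSPH (L := EbarObj ebarWellDefined X) (fun φ : MPM X.E => φ.1 x) := by
  let := ebarWellDefined.lattice X
  let : BoundedOrder (MPM X.E) := ebarWellDefined.boundedOrder X
  have hsup : ∀ φ ψ : MPM X.E, x ∈ zeroSet (φ ⊔ ψ).1 ↔ x ∈ zeroSet φ.1 ∧ x ∈ zeroSet ψ.1 :=
    fun φ ψ => Set.ext_iff.1 (MPM.isLUB_iff.1 isLUB_pair) x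
  have hinf : ∀ φ ψ : MPM X.E, x ∈ oneSet (φ ⊓ ψ).1 ↔ x ∈ oneSet φ.1 ∧ x ∈ oneSet ψ.1 :=
    fun φ ψ => Set.ext_iff.1 (MPM.isGLB_iff.1 isGLB_pair) x
  have hle1 : ∀ {φ ψ : MPM X.E}, φ ≤ ψ → x ∈ oneSet φ.1 → x ∈ oneSet ψ.1 := fun h hx => h hx
  have hle0 : ∀ {φ ψ : MPM X.E}, φ ≤ ψ → x ∈ zeroSet ψ.1 → x ∈ zeroSet φ.1 :=
    fun h hx => MPM.le_iff_zeroSet.1 h hx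
  have htop : x ∈ oneSet (⊤ : MPM X.E).1 := by
    rw [((isMPE_iff X.isTi.refl).1 (⊤ : MPM X.E).2.isMPE).1, MPM.isTop_iff.1 isTop_top]
    exact fun _ h => h.elim
  have hbot : x ∈ zeroSet (⊥ : MPM X.E).1 := by
    rw [((isMPE_iff X.isTi.refl).1 (⊥ : MPM X.E).2.isMPE).2, MPM.isBot_iff.1 isBot_bot]
    exact fun _ h => h.elim
  refine ⟨⟨hbot, htop, ?_, ?_⟩, isPFilter_of_inf_mem htop hle1 fun h h' => (hinf _ _).2 ⟨h, h'⟩,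
    isIdeal_of_sup_mem hbot hle0 fun h h' => (hsup _ _).2 ⟨h, h'⟩⟩
  · rintro φ ψ (_ | _) hs (_ | _) ht
    · exact (hsup φ ψ).2 ⟨hs, ht⟩
    · exact hle1 (le_sup_right : ψ ≤ φ ⊔ ψ) ht
    · exact hle1 (le_sup_left : φ ≤ φ ⊔ ψ) hs
    · exact hle1 (le_sup_left : φ ≤ φ ⊔ ψ) hs
  · rintro φ ψ (_ | _) hs (_ | _) ht
    · exact hle0 (inf_le_left : φ ⊓ ψ ≤ φ) hs
    · exact hle0 (inf_le_left : φ ⊓ ψ ≤ φ) hs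
    · exact hle0 (inf_le_right : φ ⊓ ψ ≤ ψ) ht
    · exact (hinf φ ψ).2 ⟨hs, ht⟩

/-- Evaluation at points, as a map from `X` into the SPH's of its lattice of MPM's. -/
noncomputable def pointEval (X : TopLGraph.{u}) (x : X.carrier) : SPH (EbarObj ebarWellDefined X) :=
  SPH.mk (L := EbarObj ebarWellDefined X) (fun φ : MPM X.E => φ.1 x) (isSPH_eval X x)

theorem pointEval_rel_iff (X : TopLGraph.{u}) (x y : X.carrier) :
    SPH.E (pointEval X x) (pointEval X y) ↔ X.E x y := by
  constructor
  · intro h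
    obtain ⟨L, e, he⟩ := X.isLGraph
    refine (he x y).1 (SPH.rel_iff.2 fun a ha ha' => ?_)
    exact SPH.rel_iff.1 h (⟨_, isMPM_pcomp_evalMap e he a⟩ : MPM X.E) ha ha'
  · exact fun h => SPH.rel_iff.2 fun (φ : MPM X.E) h1 h0 => φ.2.1.2.2.not_rel h1 h0 h

/-- Every MPM of `X` is a pulled-back evaluation at some `a : L`. Hence `g` is determined by its
composite with `L ⟶ Ē(X)`, an SPH of `L`, and the point of `X` corresponding to that SPH is the
preimage. -/
theorem pointEval_surjective (X : TopLGraph.{u}) : Function.Surjective (pointEval X) := by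
  intro g
  obtain ⟨L, e, he⟩ := X.isLGraph
  let α : X ⟶ dualSpace L :=
    ⟨e, isLGraphMorphism_of_surjective e.surjective he, e.continuous⟩
  let v : L ⟶ EbarObj ebarWellDefined X := evalHom L ≫ (Ebar ebarWellDefined).map α.op
  refine ⟨e.symm (SPH.comap v.hom g), Subtype.ext (funext fun (φ : MPM X.E) => ?_)⟩
  obtain ⟨φ, hφ⟩ := φ
  obtain ⟨a, rfl⟩ := hφ.exists_eq_evalMap e he
  change evalMap a (e (e.symm (SPH.comap v.hom g))) = _
  rw [e.apply_symm_apply]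
  rfl

theorem continuous_pointEval (X : TopLGraph.{u}) : Continuous (pointEval X) := by
  refine continuous_generateFrom_iff.2 ?_
  rintro _ ⟨(φ : MPM X.E), s, rfl⟩
  exact (isClosed_of_isPartialMorphism φ.2.1 s).isOpen_compl

/-- Evaluation at points, as a morphism `X ⟶ D̄(Ē(X))`. -/
noncomputable def pointEvalHom (X : TopLGraph.{u}) : X ⟶ dualSpace (EbarObj ebarWellDefined X) :=
  ⟨pointEval X, isLGraphMorphism_of_surjective (pointEval_surjective X) (pointEval_rel_iff X),
    continuous_pointEval X⟩

/-- The adjunction between `D̄` and `Ē`. -/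
noncomputable def dualAdjunction : Dbar.{u} dbarWellDefined ⊣ Ebar ebarWellDefined :=
  -- In each naturality square and triangle both sides apply the same partial map to the same point,
  -- so they agree definitionally.
  Adjunction.mkOfUnitCounit
    { unit :=
        { app := fun L => evalHom L
          naturality := fun _ _ _ => rfl }
      counit :=
        { app := fun X => (pointEvalHom X.unop).op
          naturality := fun _ _ _ => rfl }
      left_triangle := rfl
      right_triangle := rfl }

theorem evalHom_le_iff {L : BddLat.{u}} {a b : L} : evalHom L a ≤ evalHom L b ↔ a ≤ b :=
  oneSet_evalMap_subset_iff

theorem evalHom_surjective (L : BddLat.{u}) : Function.Surjective (evalHom L) := by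
  rintro (φ : MPM (dualSpace L).E)
  obtain ⟨a, ha⟩ := φ.2.exists_eq_evalMap (Homeomorph.refl _) fun _ _ => Iff.rfl
  exact ⟨a, Subtype.ext ha.symm⟩

theorem isIso_evalHom (L : BddLat.{u}) : IsIso (evalHom L) := by
  let e : L ≃o EbarObj ebarWellDefined (dualSpace L) :=
    RelIso.ofSurjective (OrderEmbedding.ofMapLEIff (evalHom L) fun _ _ => evalHom_le_iff)
      (evalHom_surjective L)
  have : evalHom L = (BddLat.Iso.mk e).hom := by
    ext a
    rfl
  rw [this]
  infer_instance

end Adjunction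

/-! ### Canonical extensions -/

theorem IsFilterElement.eq_sInf {L C : Type u} [CompleteLattice C] {e : L → C} {p : C}
    (hp : IsFilterElement e p) :
    p = sInf (e '' {a | p ≤ e a}) := by
  obtain ⟨A, hA⟩ := hp
  refine le_antisymm (le_sInf ?_) ?_
  · rintro _ ⟨a, ha, rfl⟩
    exact ha
  · conv_rhs => rw [hA]
    refine sInf_le_sInf (Set.image_mono fun a ha => ?_)
    exact hA.trans_le (sInf_le ⟨a, ha, rfl⟩)

theorem IsIdealElement.eq_sSup {L C : Type u} [CompleteLattice C] {e : L → C} {q : C}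
    (hq : IsIdealElement e q) :
    q = sSup (e '' {a | e a ≤ q}) := by
  obtain ⟨A, hA⟩ := hq
  refine le_antisymm ?_ (sSup_le ?_)
  · conv_lhs => rw [hA]
    refine sSup_le_sSup (Set.image_mono fun a ha => ?_)
    exact (le_sSup (Set.mem_image_of_mem e ha)).trans_eq hA.symm
  · rintro _ ⟨a, ha, rfl⟩
    exact ha

section CanonicalExtension

variable {L K C D : Type u} [Lattice L] [BoundedOrder L] [Lattice K] [BoundedOrder K]
  [CompleteLattice C] [CompleteLattice D]

theorem map_sInf_image {e : BoundedLatticeHom L C} {d : BoundedLatticeHom K D}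
    {h : CompleteLatticeHom C D} {v : L → K} (hv : ∀ a, h (e a) = d (v a)) (A : Set L) :
    h (sInf (e '' A)) = sInf (d '' (v '' A)) := by
  rw [map_sInf, Set.image_image, Set.image_image]
  simp only [hv]

theorem map_sSup_image {e : BoundedLatticeHom L C} {d : BoundedLatticeHom K D}
    {h : CompleteLatticeHom C D} {v : L → K} (hv : ∀ a, h (e a) = d (v a)) (A : Set L) :
    h (sSup (e '' A)) = sSup (d '' (v '' A)) := by
  rw [map_sSup, Set.image_image, Set.image_image]
  simp only [hv]

variable {e : BoundedLatticeHom L C} {d : BoundedLatticeHom K D}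

theorem IsCanonicalExtension.eq_sSup (he : IsCanonicalExtension e) (x : C) :
    x = sSup {p | IsFilterElement e p ∧ p ≤ x} := by
  obtain ⟨S, hS, hx⟩ := he.exists_sSup x
  refine le_antisymm ?_ (sSup_le fun p hp => hp.2)
  conv_lhs => rw [hx]
  exact sSup_le_sSup fun p hp => ⟨hS p hp, (le_sSup hp).trans_eq hx.symm⟩

theorem IsCanonicalExtension.eq_sInf (he : IsCanonicalExtension e) (x : C) :
    x = sInf {q | IsIdealElement e q ∧ x ≤ q} := by
  obtain ⟨S, hS, hx⟩ := he.exists_sInf x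
  refine le_antisymm (le_sInf fun p hp => hp.2) ?_
  conv_rhs => rw [hx]
  exact sInf_le_sInf fun p hp => ⟨hS p hp, hx.trans_le (sInf_le hp)⟩

/-- A complete homomorphism lifting `v` is the `σ`-extension of `v`. -/
theorem IsCanonicalExtension.eq_sigmaExt (he : IsCanonicalExtension e) {h : CompleteLatticeHom C D}
    {v : L → K} (hv : ∀ a, h (e a) = d (v a)) (x : C) : h x = sigmaExt e d v x := by
  conv_lhs => rw [he.eq_sSup x, map_sSup]
  refine congrArg sSup (Set.ext fun y => ?_)
  have key : ∀ p, IsFilterElement e p → h p = sInf {z | ∃ a, p ≤ e a ∧ z = d (v a)} := by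
    intro p hp
    conv_lhs => rw [hp.eq_sInf, map_sInf_image hv, Set.image_image]
    exact congrArg sInf (Set.ext fun z => exists_congr fun a => and_congr_right fun _ => eq_comm)
  constructor
  · rintro ⟨p, ⟨hp, hpx⟩, rfl⟩
    exact ⟨p, hp, hpx, key p hp⟩
  · rintro ⟨p, hp, hpx, rfl⟩
    exact ⟨p, ⟨hp, hpx⟩, key p hp⟩

/-- A complete homomorphism lifting `v` is the `π`-extension of `v`. -/
theorem IsCanonicalExtension.eq_piExt (he : IsCanonicalExtension e) {h : CompleteLatticeHom C D}
    {v : L → K} (hv : ∀ a, h (e a) = d (v a)) (x : C) : h x = piExt e d v x := by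
  conv_lhs => rw [he.eq_sInf x, map_sInf]
  refine congrArg sInf (Set.ext fun y => ?_)
  have key : ∀ q, IsIdealElement e q → h q = sSup {z | ∃ a, e a ≤ q ∧ z = d (v a)} := by
    intro q hq
    conv_lhs => rw [hq.eq_sSup, map_sSup_image hv, Set.image_image]
    exact congrArg sSup (Set.ext fun z => exists_congr fun a => and_congr_right fun _ => eq_comm)
  constructor
  · rintro ⟨q, ⟨hq, hxq⟩, rfl⟩
    exact ⟨q, hq, hxq, key q hq⟩
  · rintro ⟨q, hq, hxq, rfl⟩
    exact ⟨q, ⟨hq, hxq⟩, key q hq⟩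

/-- Complete homomorphisms on a canonical extension are determined on the lattice. -/
theorem IsCanonicalExtension.hom_ext (he : IsCanonicalExtension e) {h k : CompleteLatticeHom C D}
    (hk : ∀ a, h (e a) = k (e a)) (x : C) : h x = k x := by
  obtain ⟨S, hS, rfl⟩ := he.exists_sSup x
  rw [map_sSup, map_sSup]
  refine congrArg sSup (Set.image_congr fun p hp => ?_)
  obtain ⟨A, rfl⟩ := hS p hp
  rw [map_sInf, map_sInf, Set.image_image, Set.image_image]
  simp only [hk]

theorem sInf_image_finset (e : BoundedLatticeHom L C) (s : Finset L) :
    sInf (e '' s) = e (s.inf id) := by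
  rw [map_finset_inf, Finset.inf_eq_iInf, sInf_image]
  rfl

theorem sSup_image_finset (e : BoundedLatticeHom L C) (s : Finset L) :
    sSup (e '' s) = e (s.sup id) := by
  rw [map_finset_sup, Finset.sup_eq_iSup, sSup_image]
  rfl

/-- By compactness the inequality is witnessed by finite subsets, hence by an inequality in `L`,
which every homomorphism `d` preserves. -/
theorem IsCanonicalExtension.sInf_le_sSup (he : IsCanonicalExtension e) (d : BoundedLatticeHom L D)
    {A B : Set L} (h : sInf (e '' A) ≤ sSup (e '' B)) : sInf (d '' A) ≤ sSup (d '' B) := by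
  obtain ⟨A', hA, B', hB, hfA, hfB, hle⟩ := he.compact A B h
  lift A' to Finset L using hfA
  lift B' to Finset L using hfB
  rw [sInf_image_finset, sSup_image_finset] at hle
  have hle' : A'.inf id ≤ B'.sup id := by
    rw [← inf_eq_left] at hle ⊢
    rw [← map_inf] at hle
    exact he.injective hle
  calc sInf (d '' A) ≤ sInf (d '' A') := sInf_le_sInf (Set.image_mono hA)
    _ = d (A'.inf id) := sInf_image_finset d A'
    _ ≤ d (B'.sup id) := OrderHomClass.mono d hle'
    _ = sSup (d '' B') := (sSup_image_finset d B').symm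
    _ ≤ sSup (d '' B) := sSup_le_sSup (Set.image_mono hB)

/-- The comparison map between two completions of `L`. -/
def compareMap (e : L → C) (d : L → D) (x : C) : D := sSup {y | ∃ A, sInf (e '' A) ≤ x ∧
  y = sInf (d '' A)}

theorem le_compareMap (e : BoundedLatticeHom L C) (d : BoundedLatticeHom L D) {A : Set L} {x : C}
    (h : sInf (e '' A) ≤ x) : sInf (d '' A) ≤ compareMap e d x :=
  le_sSup ⟨A, h, rfl⟩

variable {d' : BoundedLatticeHom L D}

/-- Testing against ideal elements needs only the order between filter and ideal elements, which is
the same in both completions. As ideal elements are meet-dense, this determines `compareMap` and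
yields its inverse. -/
theorem compareMap_le_iff (he : IsCanonicalExtension e) (hd : IsCanonicalExtension d') (x : C)
    (B : Set L) : compareMap e d' x ≤ sSup (d' '' B) ↔ x ≤ sSup (e '' B) := by
  constructor
  · intro h
    rw [he.eq_sSup x]
    refine sSup_le ?_
    rintro _ ⟨⟨A, rfl⟩, hA⟩
    exact hd.sInf_le_sSup e (le_trans (le_compareMap e d' hA) h)
  · intro h
    refine sSup_le ?_
    rintro _ ⟨A, hA, rfl⟩
    exact he.sInf_le_sSup d' (hA.trans h)

theorem IsCanonicalExtension.le_of_forall_ideal (he : IsCanonicalExtension e) {x y : C}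
    (h : ∀ B : Set L, y ≤ sSup (e '' B) → x ≤ sSup (e '' B)) : x ≤ y := by
  rw [he.eq_sInf y]
  refine le_sInf ?_
  rintro _ ⟨⟨B, rfl⟩, hB⟩
  exact h B hB

theorem IsCanonicalExtension.eq_of_forall_ideal (he : IsCanonicalExtension e) {x y : C}
    (h : ∀ B : Set L, x ≤ sSup (e '' B) ↔ y ≤ sSup (e '' B)) : x = y :=
  le_antisymm (he.le_of_forall_ideal fun B => (h B).2) (he.le_of_forall_ideal fun B => (h B).1)

theorem compareMap_compareMap (he : IsCanonicalExtension e) (hd : IsCanonicalExtension d') (x : C) :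
    compareMap d' e (compareMap e d' x) = x :=
  he.eq_of_forall_ideal fun B => by rw [compareMap_le_iff hd he, compareMap_le_iff he hd]

/-- Two canonical extensions of `L` are isomorphic. -/
def compareIso (he : IsCanonicalExtension e) (hd : IsCanonicalExtension d') : C ≃o D where
  toFun := compareMap e d'
  invFun := compareMap d' e
  left_inv := compareMap_compareMap he hd
  right_inv := compareMap_compareMap hd he
  map_rel_iff' {x y} := by
    refine ⟨fun h => he.le_of_forall_ideal fun B hB => ?_, fun h => sSup_le_sSup ?_⟩
    · rw [← compareMap_le_iff he hd] at hB ⊢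
      exact le_trans h hB
    · rintro _ ⟨A, hA, rfl⟩
      exact ⟨A, hA.trans h, rfl⟩

theorem compareIso_apply (he : IsCanonicalExtension e) (hd : IsCanonicalExtension d') (a : L) :
    compareIso he hd (e a) = d' a := by
  refine hd.eq_of_forall_ideal fun B => (compareMap_le_iff he hd (e a) B).trans ?_
  have h1 := he.sInf_le_sSup d' (A := {a}) (B := B)
  have h2 := hd.sInf_le_sSup e (A := {a}) (B := B)
  simp only [Set.image_singleton, sInf_singleton] at h1 h2
  exact ⟨h1, h2⟩

end CanonicalExtension

/-! ### The canonical extension functor -/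

/-- The composite `Ḡ ∘ ♭ ∘ D̄`. -/
noncomputable abbrev canonicalFunctor : BddLat.{u} ⥤ CompleteLat.{u} :=
  Dbar dbarWellDefined ⋙ flat.op ⋙ Gbar gbarWellDefined

/-! ### Density and compactness of the evaluation embedding -/

section Embedding

variable (L : BddLat.{u})

theorem isLUB_evalMap_sup (a b : L) : IsLUB {MPE.mk (evalMap a) (isMPE_evalMap a),
    MPE.mk (evalMap b) (isMPE_evalMap b)} (MPE.mk (evalMap (a ⊔ b)) (isMPE_evalMap (a ⊔ b))) := by
  refine MPE.isLUB_of_zeroSet (SPH.isTi L).refl ?_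
  ext f
  simp only [Set.mem_insert_iff, Set.mem_singleton_iff, forall_eq_or_imp, forall_eq]
  exact Set.ext_iff.1 (zeroSet_evalMap_sup a b) f

theorem isGLB_evalMap_inf (a b : L) : IsGLB {MPE.mk (evalMap a) (isMPE_evalMap a),
    MPE.mk (evalMap b) (isMPE_evalMap b)} (MPE.mk (evalMap (a ⊓ b)) (isMPE_evalMap (a ⊓ b))) := by
  refine MPE.isGLB_of_oneSet ?_
  ext f
  simp only [Set.mem_insert_iff, Set.mem_singleton_iff, forall_eq_or_imp, forall_eq]
  exact Set.ext_iff.1 (oneSet_evalMap_inf a b) f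

theorem isTop_evalMap_top : IsTop (MPE.mk (evalMap (⊤ : L)) (isMPE_evalMap ⊤)) := fun _ =>
  (MPE.le_iff_zeroSet (SPH.isTi L).refl).2 ((zeroSet_evalMap_top L).trans_subset (Set.empty_subset _))

theorem isBot_evalMap_bot : IsBot (MPE.mk (evalMap (⊥ : L)) (isMPE_evalMap ⊥)) := fun φ =>
  (oneSet_evalMap_bot L).trans_subset (Set.empty_subset (oneSet φ.1))

/-- The evaluation embedding `L → Ḡ(♭(D̄(L)))`. -/
noncomputable def evalEmbedding : BoundedLatticeHom L (canonicalFunctor.obj L) :=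
  letI : CompleteLattice (MPE (SPH.E (L := L))) :=
    gbarWellDefined.completeLattice (flat.obj (dualSpace L))
  { toFun := fun a => (MPE.mk (evalMap a) (isMPE_evalMap a) : MPE (SPH.E (L := L)))
    map_sup' := fun a b => (isLUB_evalMap_sup L a b).unique isLUB_pair
    map_inf' := fun a b => (isGLB_evalMap_inf L a b).unique isGLB_pair
    map_top' := top_unique (isTop_evalMap_top L _)
    map_bot' := bot_unique (isBot_evalMap_bot L _) }

variable {L}

/-- An element of `Ḡ(♭(D̄(L)))`, as an MPE. -/
def toMPE (x : canonicalFunctor.obj L) : MPE (SPH.E (L := L)) := x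

theorem mem_oneSet_sInf {A : Set L} {f : SPH L} :
    f ∈ oneSet (toMPE (sInf (evalEmbedding L '' A))).1 ↔
      ∀ a ∈ A, a ∈ oneSet f.1 := by
  let := gbarWellDefined.completeLattice (flat.obj (dualSpace L))
  have h := (MPE.isGLB_iff (E := (flat.obj (dualSpace L)).E) (SPH.isTi L).refl).1
    (isGLB_sInf (evalEmbedding L '' A))
  exact (Set.ext_iff.1 h f).trans Set.forall_mem_image

theorem mem_zeroSet_sSup {A : Set L} {f : SPH L} :
    f ∈ zeroSet (toMPE (sSup (evalEmbedding L '' A))).1 ↔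
      ∀ a ∈ A, a ∈ zeroSet f.1 := by
  let := gbarWellDefined.completeLattice (flat.obj (dualSpace L))
  have h := (MPE.isLUB_iff (E := (flat.obj (dualSpace L)).E) (SPH.isTi L).refl).1
    (isLUB_sSup (evalEmbedding L '' A))
  exact (Set.ext_iff.1 h f).trans Set.forall_mem_image

theorem evalEmbedding_injective : Function.Injective (evalEmbedding L) := by
  intro a b h
  have h' : evalMap a = evalMap b := congrArg (Subtype.val (p := IsMPE (SPH.E (L := L)))) h
  exact le_antisymm (oneSet_evalMap_subset_iff.1 (by rw [h']))
    (oneSet_evalMap_subset_iff.1 (by rw [h']))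

theorem IsMPE.mem_oneSet_of_le₁ {φ : SPH L →. Bool} (h : IsMPE SPH.E φ) {f g : SPH L}
    (hf : f ∈ oneSet φ) (hfg : oneSet f.1 ⊆ oneSet g.1) : g ∈ oneSet φ := by
  rw [((isMPE_iff_stable (SPH.isTi L)).1 h).1] at hf ⊢
  exact ellMap_upward _ (SPH.le₁_iff.2 hfg) hf

theorem IsMPE.mem_zeroSet_of_le₂ {φ : SPH L →. Bool} (h : IsMPE SPH.E φ) {f g : SPH L}
    (hf : f ∈ zeroSet φ) (hfg : zeroSet f.1 ⊆ zeroSet g.1) : g ∈ zeroSet φ := by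
  rw [((isMPE_iff_stable (SPH.isTi L)).1 h).2] at hf ⊢
  exact rMap_upward _ (SPH.le₂_iff.2 hfg) hf

/-- If no finite subsets work, the filter generated by `A` is disjoint from the ideal generated by
`B`. The resulting SPH lies in the `1`-set of `⋀ A` and in the `0`-set of `⋁ B`, contradicting the
inequality. -/
theorem evalEmbedding_compact (A B : Set L)
    (h : sInf (evalEmbedding L '' A) ≤ sSup (evalEmbedding L '' B)) :
    ∃ A' ⊆ A, ∃ B' ⊆ B, A'.Finite ∧ B'.Finite ∧
      sInf (evalEmbedding L '' A') ≤ sSup (evalEmbedding L '' B') := by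
  by_contra! hne
  have hF : Order.IsPFilter {a : L | ∃ A' ⊆ A, A'.Finite ∧
      sInf (evalEmbedding L '' A') ≤ evalEmbedding L a} := by
    refine isPFilter_of_inf_mem ⟨∅, Set.empty_subset _, Set.finite_empty, ?_⟩ ?_ ?_
    · rw [map_top]
      exact le_top
    · rintro a b hab ⟨A', h1, h2, h3⟩
      exact ⟨A', h1, h2, h3.trans (OrderHomClass.mono _ hab)⟩
    · rintro a b ⟨A', h1, h2, h3⟩ ⟨A'', h1', h2', h3'⟩
      refine ⟨A' ∪ A'', Set.union_subset h1 h1', h2.union h2', ?_⟩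
      rw [Set.image_union, sInf_union, map_inf]
      exact inf_le_inf h3 h3'
  have hI : Order.IsIdeal {a : L | ∃ B' ⊆ B, B'.Finite ∧
      evalEmbedding L a ≤ sSup (evalEmbedding L '' B')} := by
    refine isIdeal_of_sup_mem ⟨∅, Set.empty_subset _, Set.finite_empty, ?_⟩ ?_ ?_
    · rw [map_bot]
      exact bot_le
    · rintro a b hab ⟨B', h1, h2, h3⟩
      exact ⟨B', h1, h2, le_trans (OrderHomClass.mono _ hab) h3⟩
    · rintro a b ⟨B', h1, h2, h3⟩ ⟨B'', h1', h2', h3'⟩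
      refine ⟨B' ∪ B'', Set.union_subset h1 h1', h2.union h2', ?_⟩
      rw [Set.image_union, sSup_union, map_sup]
      exact sup_le_sup h3 h3'
  let f : SPH L := SPH.ofPair _ _ hF hI <| by
    rintro a ⟨A', h1, h2, h3⟩ ⟨B', h1', h2', h3'⟩
    exact hne A' h1 B' h1' h2 h2' (h3.trans h3')
  have hf1 : f ∈ oneSet (toMPE (sInf (evalEmbedding L '' A))).1 :=
    mem_oneSet_sInf.2 fun a ha => (SPH.oneSet_ofPair hF hI _).symm.subset
      ⟨{a}, Set.singleton_subset_iff.2 ha, Set.finite_singleton a, by simp⟩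
  have hf0 : f ∈ zeroSet (toMPE (sSup (evalEmbedding L '' B))).1 :=
    mem_zeroSet_sSup.2 fun a ha => (SPH.zeroSet_ofPair hF hI _).symm.subset
      ⟨{a}, Set.singleton_subset_iff.2 ha, Set.finite_singleton a, by simp⟩
  exact true_mem_false_mem (h hf1) hf0

/-- The meet of the evaluations over the filter of `f` has as `1`-set the points above `f` in `≤₁`.
The `1`-set of an MPE is upward closed, so it is the union of these cones. -/
theorem evalEmbedding_exists_sSup (x : canonicalFunctor.obj L) :
    ∃ S : Set (canonicalFunctor.obj L),
      (∀ p ∈ S, IsFilterElement (evalEmbedding L) p) ∧ x = sSup S := by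
  let φ := toMPE x
  refine ⟨{p | ∃ f ∈ oneSet φ.1, p = sInf (evalEmbedding L '' oneSet (Subtype.val f))}, ?_, ?_⟩
  · rintro _ ⟨f, -, rfl⟩
    exact ⟨_, rfl⟩
  · refine le_antisymm (fun f hf => ?_) (sSup_le ?_)
    · refine (le_sSup ?_ : sInf (evalEmbedding L '' oneSet (Subtype.val f)) ≤ _)
        (mem_oneSet_sInf.2 fun _ ha => ha)
      exact ⟨f, hf, rfl⟩
    · rintro _ ⟨f, hf, rfl⟩ g hg
      exact φ.2.mem_oneSet_of_le₁ hf (mem_oneSet_sInf.1 hg)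

theorem evalEmbedding_exists_sInf (x : canonicalFunctor.obj L) :
    ∃ S : Set (canonicalFunctor.obj L),
      (∀ q ∈ S, IsIdealElement (evalEmbedding L) q) ∧ x = sInf S := by
  let φ := toMPE x
  have hle : ∀ {ψ χ : MPE (flat.obj (dualSpace L)).E}, ψ ≤ χ ↔ zeroSet χ.1 ⊆ zeroSet ψ.1 :=
    MPE.le_iff_zeroSet (SPH.isTi L).refl
  refine ⟨{q | ∃ f ∈ zeroSet φ.1, q = sSup (evalEmbedding L '' zeroSet (Subtype.val f))}, ?_, ?_⟩
  · rintro _ ⟨f, -, rfl⟩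
    exact ⟨_, rfl⟩
  · refine le_antisymm (le_sInf ?_) (hle.2 fun f hf => ?_)
    · rintro _ ⟨f, hf, rfl⟩
      exact hle.2 fun g hg => φ.2.mem_zeroSet_of_le₂ hf (mem_zeroSet_sSup.1 hg)
    · refine hle.1 (sInf_le ?_ : _ ≤ sSup (evalEmbedding L '' zeroSet (Subtype.val f)))
        (mem_zeroSet_sSup.2 fun _ ha => ha)
      exact ⟨f, hf, rfl⟩

theorem isCanonicalExtension_evalEmbedding : IsCanonicalExtension (evalEmbedding L) where
  injective := evalEmbedding_injective
  exists_sSup := evalEmbedding_exists_sSup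
  exists_sInf := evalEmbedding_exists_sInf
  compact := evalEmbedding_compact

end Embedding

/-- The evaluation embeddings form a natural family. -/
noncomputable def evalNatTrans :
    𝟭 BddLat.{u} ⟶ canonicalFunctor ⋙ forget₂ CompleteLat.{u} BddLat.{u} where
  app L := BddLat.ofHom (evalEmbedding L)
  naturality _ _ _ := rfl

/-- Canonical extension functors are unique up to a unique natural isomorphism commuting with the
embeddings. -/
theorem existsUnique_iso {Δ Δ' : BddLat.{u} ⥤ CompleteLat.{u}}
    {η : 𝟭 BddLat.{u} ⟶ Δ ⋙ forget₂ CompleteLat.{u} BddLat.{u}}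
    {η' : 𝟭 BddLat.{u} ⟶ Δ' ⋙ forget₂ CompleteLat.{u} BddLat.{u}}
    (h : IsCanonicalExtensionFunctor Δ η) (h' : IsCanonicalExtensionFunctor Δ' η') :
    ∃! i : Δ ≅ Δ', ∀ (L : BddLat.{u}) (a : L),
      i.hom.app L ((η.app L).hom a) = (η'.app L).hom a := by
  have nat : ∀ {Δ : BddLat.{u} ⥤ CompleteLat.{u}}
      (η : 𝟭 BddLat.{u} ⟶ Δ ⋙ forget₂ CompleteLat.{u} BddLat.{u}) {L K : BddLat.{u}} (f : L ⟶ K)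
      (a : L), Δ.map f ((η.app L).hom a) = (η.app K).hom (f a) := fun η L K f a =>
    (congrArg (fun g => BddLat.Hom.hom g a) (η.naturality f)).symm
  refine ⟨NatIso.ofComponents (fun L => CompleteLat.Iso.mk (compareIso (h L) (h' L))) ?_, ?_, ?_⟩
  · intro L K f
    ext x
    -- Complete homomorphisms out of a canonical extension are determined on `L`, so naturality of
    -- the comparison reduces to that of `η` and `η'`; uniqueness below follows the same way.
    refine (h L).hom_ext (fun a => ?_) x
    have e1 : compareIso (h K) (h' K) (Δ.map f ((η.app L).hom a)) = (η'.app K).hom (f a) := by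
      rw [nat η f a]
      exact compareIso_apply (h K) (h' K) (f a)
    have e2 : Δ'.map f (compareIso (h L) (h' L) ((η.app L).hom a)) = (η'.app K).hom (f a) := by
      rw [compareIso_apply (h L) (h' L) a]
      exact nat η' f a
    exact e1.trans e2.symm
  · exact fun L a => compareIso_apply (h L) (h' L) a
  · intro j hj
    ext L x
    exact (h L).hom_ext (fun a => (hj L a).trans (compareIso_apply (h L) (h' L) a).symm) x

end LatDual

open CategoryTheory Opposite LatDual in
theorem mainTheorem2 :
    -- (i) `D̄` and `Ḡ` are well-defined functors
    ∃ (hD : DbarWellDefined.{u}) (hG : GbarWellDefined.{u}),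
    -- (ii) `D̄` has the right adjoint `Ē`; the unit consists of evaluation maps and is invertible
    (∃ (hE : EbarWellDefined.{u}) (adj : Dbar hD ⊣ Ebar hE),
      ∀ L : BddLat.{u},
        (∀ a : L, ((adj.unit.app L).hom a : MPM (dualSpace L).E).1 = evalMap a) ∧
        IsIso (adj.unit.app L)) ∧
    -- (iii) `Ḡ ∘ ♭ ∘ D̄`, with the evaluation maps as embeddings, is the canonical extension functor
    (∃ ε : 𝟭 BddLat.{u} ⟶
        (Dbar hD ⋙ flat.op ⋙ Gbar hG) ⋙ forget₂ CompleteLat.{u} BddLat.{u},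
      (∀ (L : BddLat.{u}) (a : L),
        ((ε.app L).hom a : MPE (flat.obj (dualSpace L)).E).1 = evalMap a) ∧
      IsCanonicalExtensionFunctor (Dbar hD ⋙ flat.op ⋙ Gbar hG) ε ∧
      (∀ (L K : BddLat.{u}) (f : L ⟶ K) (x : (Dbar hD ⋙ flat.op ⋙ Gbar hG).obj L),
        (Dbar hD ⋙ flat.op ⋙ Gbar hG).map f x =
            sigmaExt (C := (Dbar hD ⋙ flat.op ⋙ Gbar hG).obj L)
              (D := (Dbar hD ⋙ flat.op ⋙ Gbar hG).obj K)
              (ε.app L).hom (ε.app K).hom (fun a : L => f a) x ∧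
        (Dbar hD ⋙ flat.op ⋙ Gbar hG).map f x =
            piExt (C := (Dbar hD ⋙ flat.op ⋙ Gbar hG).obj L)
              (D := (Dbar hD ⋙ flat.op ⋙ Gbar hG).obj K)
              (ε.app L).hom (ε.app K).hom (fun a : L => f a) x) ∧
      ∀ (Δ : BddLat.{u} ⥤ CompleteLat.{u})
        (η : 𝟭 BddLat.{u} ⟶ Δ ⋙ forget₂ CompleteLat.{u} BddLat.{u}),
        IsCanonicalExtensionFunctor Δ η →
        ∃! i : Dbar hD ⋙ flat.op ⋙ Gbar hG ≅ Δ,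
          ∀ (L : BddLat.{u}) (a : L), i.hom.app L ((ε.app L).hom a) = (η.app L).hom a) := by
  refine ⟨dbarWellDefined, gbarWellDefined,
    ⟨ebarWellDefined, dualAdjunction, fun L => ⟨fun _ => rfl, isIso_evalHom L⟩⟩,
    evalNatTrans, fun _ _ => rfl, fun _ => isCanonicalExtension_evalEmbedding, fun L K f x => ?_,
    fun Δ η h => existsUnique_iso (fun _ => isCanonicalExtension_evalEmbedding) h⟩
  exact ⟨isCanonicalExtension_evalEmbedding.eq_sigmaExt (h := canonicalFunctor.map f)
      (d := evalEmbedding K) (v := fun a => f a) (fun _ => rfl) x,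
    isCanonicalExtension_evalEmbedding.eq_piExt (h := canonicalFunctor.map f)
      (d := evalEmbedding K) (v := fun a => f a) (fun _ => rfl) x⟩
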